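/- Let $\tilde X$ be a locally compact metric space with an isometric, properly discontinuous action of a discrete group $G$ such that the quotient map $p:\tilde X\to X:=\tilde X/G$ is a covering with group $G$ (so the action is free) and $X$ is compact. Let $\tilde r:\tilde X\to\tilde X$ be a homeomorphism such that, for some $0<\theta<1$, $d(x,y)\le\theta\, d(\tilde r x,\tilde r y)$ for all $x,y\in\tilde X$, and let $A$ be an endomorphism of $G$ with $AG$ normal in $G$ and $\tilde r(gx)=(Ag)\,\tilde r x$ for $g\in G$, $x\in\tilde X$. Let $r:X\to X$ be the induced map $r(p(x))=p(\tilde r x)$, let $g_1,\dots,g_q$ be a (finite) complete system of representatives of the right cosets of $AG$ in $G$, and put $\psi_i=\tilde r^{-1}\circ g_i$, so that $r(p\psi_i x)=p(x)$. Let $\xi\to X$ be a $d$-dimensional complex vector bundle with a (continuous) Hermitian metric and with a Lipschitz structure, i.e. a system of local trivializations $\phi_i:\xi|_{U_i}\to U_i\times\mathbb C^d$ covering $X$ whose changes of coordinates $U_i\cap U_j\to GL_d(\mathbb C)$ are Lipschitz for the quotient metric of $X$. Assume that $p^*\xi$ is a trivial $d$-bundle. Let $\mathrm{End}(\xi)$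 be the set of continuous bundle maps $\xi\to\xi$ over $X$, with $\|f\|=\sup_{x\in X}\|f(x)\|$ and with the fibrewise adjoint. Let $m:r^*\xi\to\xi$ be a Lipschitz bundle map, i.e. its matrices in the given local trivializations are Lipschitz functions, and let $R$ be the transfer operator on $\mathrm{End}(\xi)$, $$(Rf)(p x)=\sum_{i=1}^q m^*(p\psi_i x)\,f(p\psi_i x)\,m(p\psi_i x),\qquad x\in\tilde X .$$ Assume that there is $h\in\mathrm{End}(\xi)$ that is positive, invertible and harmonic, i.e. $Rh=h$. Let $\mathfrak H=\{f\in\mathrm{End}(\xi): Rf=f\}$. Then for every $g\in\mathrm{End}(\xi)$ the Cesàro means $k^{-1}\sum_{j=1}^kR^jg$ converge uniformly on $X$, and their limit $T_1g$ belongs to $\mathfrak H$. The set $\mathfrak H$ is a finite-dimensional $C^*$-algebra with the usual (pointwise) addition, multiplication by complex scalars and adjoint, with the product $$h_1*h_2=T_1(h_1h^{-1}h_2),$$ and with the norm $\|f\|_h=\|h^{-1/2}fh^{-1/2}\|=\sup_{x\in X}\|h(x)^{-1/2}f(x)h(x)^{-1/2}\|$. -/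

import Mathlib

open Bundle Filter Topology
open scoped NNReal

noncomputable section

namespace MatrixTransfer

/-- The orbit space `X = X̃ / G`; it carries the quotient topology. -/
abbrev Base (G Y : Type*) [Group G] [MulAction G Y] : Type _ := MulAction.orbitRel.Quotient G Y

/-- The quotient map `p : X̃ → X = X̃ / G`. -/
def proj (G : Type*) {Y : Type*} [Group G] [MulAction G Y] (y : Y) : Base G Y :=
  Quotient.mk _ y

theorem proj_smul {G Y : Type*} [Group G] [MulAction G Y] (g : G) (y : Y) :
    proj G (g • y) = proj G y :=
  MulAction.orbitRel.Quotient.quotient_smul_eq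

/-- A strictly expansive homeomorphism `r̃` of `X̃`, an endomorphism `A` of `G` with normal image
such that `r̃ (g x) = (A g) (r̃ x)`, and a finite complete system `g₁, …, g_q` of representatives of
the right cosets `(A G) g` of `A G` in `G`. -/
structure Dilation (G Y : Type*) [Group G] [MulAction G Y] [MetricSpace Y] where
  /-- the expansive homeomorphism -/
  dil : Y ≃ₜ Y
  /-- the expansion constant -/
  θ : ℝ
  θ_pos : 0 < θ
  θ_lt_one : θ < 1
  expansive : ∀ x y : Y, dist x y ≤ dist (dil x) (dil y) * θ
  /-- the endomorphism of the group -/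
  A : G →* G
  range_normal : A.range.Normal
  dil_smul : ∀ (g : G) (y : Y), dil (g • y) = A g • dil y
  /-- the number of right cosets -/
  q : ℕ
  /-- the coset representatives -/
  rep : Fin q → G
  rep_complete : ∀ g : G, ∃! i : Fin q, ∃ a : G, g = A a * rep i

namespace Dilation

variable {G Y : Type*} [Group G] [MulAction G Y] [MetricSpace Y] (D : Dilation G Y)

/-- The induced map `r : X → X`, `r (p x) = p (r̃ x)`. -/
def baseMap : Base G Y → Base G Y :=
  Quotient.lift (fun y => proj G (D.dil y)) (by
    rintro a b ⟨g, rfl⟩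
    change proj G (D.dil (g • b)) = proj G (D.dil b)
    rw [D.dil_smul, proj_smul])

theorem baseMap_proj (y : Y) : D.baseMap (proj G y) = proj G (D.dil y) := rfl

/-- The inverse branches `ψ_i = r̃⁻¹ ∘ g_i`. -/
def branch (i : Fin D.q) (y : Y) : Y := D.dil.symm (D.rep i • y)

theorem baseMap_branch (i : Fin D.q) (y : Y) :
    D.baseMap (proj G (D.branch i y)) = proj G y := by
  rw [baseMap_proj, branch, Homeomorph.apply_symm_apply, proj_smul]

end Dilation

section Transport

variable {X : Type*} {E : X → Type*} [∀ x, NormedAddCommGroup (E x)]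
  [∀ x, InnerProductSpace ℂ (E x)]

/-- Transport of an endomorphism of a fibre along an equality of base points. -/
def transportEnd {x x' : X} (e : x = x') (T : E x →L[ℂ] E x) : E x' →L[ℂ] E x' :=
  e ▸ T

theorem transportEnd_sum {x x' : X} (e : x = x') {ι : Type*} (s : Finset ι)
    (T : ι → (E x →L[ℂ] E x)) :
    transportEnd e (∑ i ∈ s, T i) = ∑ i ∈ s, transportEnd e (T i) := by
  subst e; rfl

theorem transportEnd_trans {x x' x'' : X} (e : x = x') (e' : x' = x'') (T : E x →L[ℂ] E x) :
    transportEnd e' (transportEnd e T) = transportEnd (e.trans e') T := by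
  subst e; rfl

theorem transportEnd_congr {Z : Type*} (r : Z → X) (W : ∀ z, E (r z) →L[ℂ] E (r z)) {z z' : Z}
    (h : z = z') {x : X} (e : r z = x) (e' : r z' = x) :
    transportEnd e (W z) = transportEnd e' (W z') := by
  subst h; rfl

end Transport

section Operators

variable {G Y : Type*} [Group G] [MulAction G Y] [MetricSpace Y] (D : Dilation G Y)
  {E : Base G Y → Type*} [∀ x, NormedAddCommGroup (E x)] [∀ x, InnerProductSpace ℂ (E x)]
  [∀ x, CompleteSpace (E x)]

/-- The endomorphism `m* h m` of the fibre of `r^* ξ` over `z`, i.e. of `ξ_{r z}`. -/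
def pullEnd (m : ∀ x, E (D.baseMap x) →L[ℂ] E x) (h : ∀ x, E x →L[ℂ] E x) (z : Base G Y) :
    E (D.baseMap z) →L[ℂ] E (D.baseMap z) :=
  (ContinuousLinearMap.adjoint (m z)).comp ((h z).comp (m z))

/-- The sum `∑ i, m* (p ψ_i y) h (p ψ_i y) m (p ψ_i y)`, an endomorphism of `ξ_{p y}`
(recall that `r (p ψ_i y) = p y`). -/
def transferSum (m : ∀ x, E (D.baseMap x) →L[ℂ] E x) (h : ∀ x, E x →L[ℂ] E x) (y : Y) :
    E (proj G y) →L[ℂ] E (proj G y) :=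
  ∑ i : Fin D.q, transportEnd (D.baseMap_branch i y) (pullEnd D m h (proj G (D.branch i y)))

theorem transferSum_compat (m : ∀ x, E (D.baseMap x) →L[ℂ] E x) (h : ∀ x, E x →L[ℂ] E x)
    (a b : Y) (e : proj G a = proj G b) :
    transportEnd e (transferSum D m h a) = transferSum D m h b := by
  obtain ⟨k, hk⟩ : ∃ k : G, k • b = a := Quotient.exact e
  have key : ∀ i : Fin D.q, ∃ j : Fin D.q, ∃ c : G, D.rep i * k = D.A c * D.rep j :=
    fun i => (D.rep_complete (D.rep i * k)).exists
  choose σ c hσ using key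
  have inj : Function.Injective σ := by
    intro i i' hii
    have h1 : D.rep i = D.A (c i * (c i')⁻¹) * D.rep i' := by
      have h2 := hσ i
      rw [hii, ← inv_mul_eq_iff_eq_mul.mpr (hσ i')] at h2
      rw [map_mul, map_inv, ← mul_left_inj k, h2]
      group
    exact (D.rep_complete (D.rep i)).unique ⟨1, by simp⟩ ⟨_, h1⟩
  have hbr : ∀ i, proj G (D.branch i a) = proj G (D.branch (σ i) b) := by
    intro i
    have h1 : D.branch i a = c i • D.branch (σ i) b := by
      apply D.dil.injective
      rw [D.dil_smul, Dilation.branch, Dilation.branch, Homeomorph.apply_symm_apply,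
        Homeomorph.apply_symm_apply, ← hk, smul_smul, hσ i, mul_smul]
    rw [h1, proj_smul]
  rw [transferSum, transferSum, transportEnd_sum]
  refine Fintype.sum_bijective σ (Finite.injective_iff_bijective.mp inj) _ _ fun i => ?_
  rw [transportEnd_trans]
  exact transportEnd_congr D.baseMap (pullEnd D m h) (hbr i) _ _

/-- The transfer operator: `(R h) (p y) = ∑ i, m* (p ψ_i y) h (p ψ_i y) m (p ψ_i y)`. -/
def transfer (m : ∀ x, E (D.baseMap x) →L[ℂ] E x) (h : ∀ x, E x →L[ℂ] E x) :
    ∀ x, E x →L[ℂ] E x :=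
  fun x => Quotient.rec (motive := fun x => E x →L[ℂ] E x) (fun y => transferSum D m h y)
    (fun a b hab => transferSum_compat D m h a b (Quotient.sound hab)) x

theorem transfer_proj (m : ∀ x, E (D.baseMap x) →L[ℂ] E x) (h : ∀ x, E x →L[ℂ] E x) (y : Y) :
    transfer D m h (proj G y) = transferSum D m h y := rfl

/-- The Cesàro means `k⁻¹ ∑_{j=1}^k R^j g`. -/
def cesaro (m : ∀ x, E (D.baseMap x) →L[ℂ] E x) (g : ∀ x, E x →L[ℂ] E x) (k : ℕ) (x : Base G Y) :
    E x →L[ℂ] E x :=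
  (k : ℂ)⁻¹ • ∑ j ∈ Finset.Icc 1 k, ((transfer D m)^[j] g) x

/-- `T₁ g = lim_k k⁻¹ ∑_{j=1}^k R^j g` (the limit is taken pointwise here; that it is uniform
on `X` is part of the assertions made about it). -/
def cesaroProj (m : ∀ x, E (D.baseMap x) →L[ℂ] E x) (g : ∀ x, E x →L[ℂ] E x) (x : Base G Y) :
    E x →L[ℂ] E x :=
  limUnder atTop (fun k => cesaro D m g k x)

end Operators

section Bundles

variable {X : Type*} [TopologicalSpace X] (F : Type*) [NormedAddCommGroup F] [NormedSpace ℂ F]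
  (E : X → Type*) [∀ x, NormedAddCommGroup (E x)] [∀ x, InnerProductSpace ℂ (E x)]
  [TopologicalSpace (TotalSpace F E)]

/-- `h ∈ End ξ`: the fibrewise linear map `h` is a continuous map on the total space. -/
def IsBundleEnd (h : ∀ x, E x →L[ℂ] E x) : Prop :=
  Continuous (fun v : TotalSpace F E => (⟨v.1, h v.1 v.2⟩ : TotalSpace F E))

/-- The inner products of the fibres form a (continuous) Hermitian metric: they define a continuous
function on `ξ ×_X ξ`. -/
def IsHermitianMetric : Prop :=
  Continuous (fun v : TotalSpace (F × F) (E ×ᵇ E) => inner ℂ v.2.1 v.2.2)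

end Bundles

section Lipschitz

variable {G Y : Type*} [Group G] [MulAction G Y] [MetricSpace Y]
  (F : Type*) [NormedAddCommGroup F] [NormedSpace ℂ F]
  (E : Base G Y → Type*) [∀ x, NormedAddCommGroup (E x)] [∀ x, InnerProductSpace ℂ (E x)]
  [TopologicalSpace (TotalSpace F E)] [FiberBundle F E] [VectorBundle ℂ F E]

/-- A Lipschitz structure on `ξ`: a trivializing system with Lipschitz changes of coordinates.
The metric of `X` is the quotient metric `d (p x, p y) = inf_g d (x, g y)`, for which a function on
a subset `U` of `X` is Lipschitz if and only if its lift to `p⁻¹ U ⊆ X̃` is (with the same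
constant); the conditions are written for the lifts. -/
structure LipschitzAtlas where
  /-- the index set of the trivializing system -/
  ι : Type
  /-- the local trivializations -/
  triv : ι → Trivialization F (π F E)
  linear : ∀ i, (triv i).IsLinear ℂ
  cover : ∀ x : Base G Y, ∃ i, x ∈ (triv i).baseSet
  lipschitz : ∀ i j, ∃ K : ℝ≥0, LipschitzOnWith K
    (fun y : Y => ((triv i).coordChangeL ℂ (triv j) (proj G y) : F →L[ℂ] F))
    {y | proj G y ∈ (triv i).baseSet ∩ (triv j).baseSet}

variable {F E}

/-- The bundle map `m : r^* ξ → ξ` is Lipschitz: its matrices in the local trivializations are. -/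
def LipschitzAtlas.IsLipschitzMap (𝒜 : LipschitzAtlas F E) (D : Dilation G Y)
    (m : ∀ x, E (D.baseMap x) →L[ℂ] E x) : Prop :=
  haveI := 𝒜.linear
  ∀ i j, ∃ K : ℝ≥0, LipschitzOnWith K
    (fun y : Y => ((𝒜.triv i).continuousLinearMapAt ℂ (proj G y)).comp
      ((m (proj G y)).comp ((𝒜.triv j).symmL ℂ (D.baseMap (proj G y)))))
    {y | proj G y ∈ (𝒜.triv i).baseSet ∧ D.baseMap (proj G y) ∈ (𝒜.triv j).baseSet}

variable (F E) in
/-- The pull-back `p^* ξ` is a trivial `d`-bundle: it has `d` continuous sections which form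
a basis in each fibre (here `d` is the rank of `ξ`). -/
def PullbackIsTrivial (d : ℕ) : Prop :=
  ∃ s : Fin d → ∀ y : Y, E (proj G y),
    (∀ i, Continuous (fun y : Y => (⟨proj G y, s i y⟩ : TotalSpace F E))) ∧
    ∀ y, LinearIndependent ℂ (fun i => s i y)

end Lipschitz

/-- The set `ℌ` of continuous harmonic maps: all `f ∈ End ξ` with `R f = f`. -/
def Harmonic {G Y : Type*} [Group G] [MulAction G Y] [MetricSpace Y] (D : Dilation G Y)
    (F : Type*) {E : Base G Y → Type*} [∀ x, NormedAddCommGroup (E x)]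
    [∀ x, InnerProductSpace ℂ (E x)] [∀ x, CompleteSpace (E x)]
    [TopologicalSpace (TotalSpace F E)] (m : ∀ x, E (D.baseMap x) →L[ℂ] E x) : Type _ :=
  {f : ∀ x, E x →L[ℂ] E x // IsBundleEnd F E f ∧ transfer D m f = f}

end MatrixTransfer

end

/-!
Read as an action on the sesquilinear forms `⟨v, f u⟩` of the fibres, the transfer operator is a sum
of pull-backs, `⟨v, (R f) u⟩ = ∑ i, ⟨n_i v, f n_i u⟩` with `n_i = m (p ψ_i y)`
(`inner_transfer_proj`). The Hermitian metric, which is merely continuous, drops out of this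
formula, and only the Lipschitz map `m` and the contractions `ψ_i` remain. Sizes are measured
against `h`: `FormBound h f c` says that `|⟨v, f u⟩| ≤ c (⟨u, h u⟩ + ⟨v, h v⟩) / 2`, which is
the same as `‖f‖_h ≤ c`, and `R h = h` shows at once that `R` preserves such a bound.

Moduli of continuity are compared in finitely many charts, again against `h` (`OscBound`). As
`R h = h`, one application of `R` turns the modulus `t ↦ ε + L t` at scale `θ η` into
`t ↦ ε + (θ L + K ‖f‖_h) t` at scale `η` (`exists_oscBound_transfer`). Two consequences follow. The
orbit of any `g ∈ End ξ` is equicontinuous, and the modulus of continuity of a harmonic `f` is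
`K ‖f‖_h t` at a fixed scale, because `f = R^n f` for every `n`. On the other hand a section with a
small modulus of continuity is controlled by its values on a fine finite net
(`OscBound.formBound_of_net`). Hence a harmonic section that vanishes on a suitable finite set
vanishes, and the harmonic sections form a finite-dimensional space. Likewise a pointwise cluster
point of the Cesàro means is a uniform one; it is fixed by `R`, and it is the limit of the whole
sequence since `g - A_n g` is a coboundary and `R` is power bounded (`exists_cesaro_limit`).

The product is that of Choi and Effros. The positivity of the block matrix
`[[b* h⁻¹ b, b*], [b, h]]` is inherited by `[[T₁ (b* h⁻¹ b), (T₁ b)*], [T₁ b, h]]`, because `T₁`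
is a limit of averages of sums of pull-backs (`blockPos_cesaroProj_twist`). This contains a Schwarz
inequality for `T₁`, which implies `T₁ (d* h⁻¹ a) = 0` if `T₁ d = 0` and `a` is harmonic
(`cesaroProj_twist_eq_zero`), and with it the associativity of the product. The same inequality
gives `f* h⁻¹ f ≤ T₁ (f* h⁻¹ f)` for harmonic `f`, which is the nontrivial half of the
`C*`-identity.
-/

noncomputable section

set_option linter.unusedSectionVars false

namespace MatrixTransfer

/-! ### Sesquilinear forms and the transfer operator -/

section Forms

variable {X : Type*} {E : X → Type*} [∀ x, NormedAddCommGroup (E x)]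
  [∀ x, InnerProductSpace ℂ (E x)] {h f g : ∀ x, E x →L[ℂ] E x} {a b : ℝ}

theorem clm_ext_inner {V : Type*} [NormedAddCommGroup V] [InnerProductSpace ℂ V] {S T : V →L[ℂ] V}
    (hST : ∀ u v, inner ℂ v (S u) = inner ℂ v (T u)) : S = T :=
  ContinuousLinearMap.ext fun u => ext_inner_left ℂ fun v => hST u v

/-- The fibrewise adjoint. -/
def starSec [∀ x, CompleteSpace (E x)] (f : ∀ x, E x →L[ℂ] E x) (x : X) : E x →L[ℂ] E x :=
  ContinuousLinearMap.adjoint (f x)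

/-- The quadratic form `⟨u, h u⟩` of `h`. -/
def quad (h : ∀ x, E x →L[ℂ] E x) {x : X} (u : E x) : ℝ := (inner ℂ u (h x u)).re

/-- `|⟨v, f u⟩| ≤ c (⟨u, h u⟩ + ⟨v, h v⟩) / 2` for all `u`, `v` in the same fibre. By scaling this
says `|⟨v, f u⟩| ≤ c ⟨u, h u⟩ ^ (1/2) ⟨v, h v⟩ ^ (1/2)`, i.e. `‖h ^ (-1/2) f h ^ (-1/2)‖ ≤ c`, but
the present form is additive in the pairs `(u, v)`. -/
def FormBound (h f : ∀ x, E x →L[ℂ] E x) (c : ℝ) : Prop :=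
  ∀ (x : X) (u v : E x), ‖inner ℂ v (f x u)‖ ≤ c * ((quad h u + quad h v) / 2)

theorem quad_smul {x : X} (r : ℂ) (u : E x) : quad h (r • u) = ‖r‖ ^ 2 * quad h u := by
  rw [quad, quad, map_smul, inner_smul_left, inner_smul_right, ← mul_assoc,
    ← Complex.normSq_eq_conj_mul_self, Complex.re_ofReal_mul, Complex.normSq_eq_norm_sq]

theorem quad_nonneg (hpos : ∀ x, (h x).IsPositive) {x : X} (u : E x) : 0 ≤ quad h u :=
  (hpos x).re_inner_nonneg_right u

theorem FormBound.add (hf : FormBound h f a) (hg : FormBound h g b) :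
    FormBound h (f + g) (a + b) := fun x u v => by
  rw [Pi.add_apply, add_apply, inner_add_right, add_mul]
  exact (norm_add_le _ _).trans (add_le_add (hf x u v) (hg x u v))

theorem FormBound.smul (hf : FormBound h f a) (r : ℂ) :
    FormBound h (r • f) (‖r‖ * a) := fun x u v => by
  rw [Pi.smul_apply, smul_apply, inner_smul_right, norm_mul, mul_assoc]
  exact mul_le_mul_of_nonneg_left (hf x u v) (norm_nonneg _)

theorem FormBound.neg (hf : FormBound h f a) : FormBound h (-f) a := fun x u v => by
  rw [Pi.neg_apply, neg_apply, inner_neg_right, norm_neg]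
  exact hf x u v

theorem FormBound.sub (hf : FormBound h f a) (hg : FormBound h g b) :
    FormBound h (f - g) (a + b) := by
  rw [sub_eq_add_neg]; exact hf.add hg.neg

theorem FormBound.zero : FormBound h (0 : ∀ x, E x →L[ℂ] E x) 0 := fun x u v => by simp

theorem FormBound.sum {ι : Type*} (s : Finset ι) {f : ι → ∀ x, E x →L[ℂ] E x}
    (hf : ∀ i ∈ s, FormBound h (f i) a) : FormBound h (∑ i ∈ s, f i) (s.card * a) := by
  classical
  induction s using Finset.induction_on with
  | empty => simpa using FormBound.zero
  | insert i s hi ih =>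
    rw [Finset.sum_insert hi, Finset.card_insert_of_notMem hi]
    have := (hf i (Finset.mem_insert_self i s)).add
      (ih fun j hj => hf j (Finset.mem_insert_of_mem hj))
    convert this using 1
    push_cast; ring

theorem FormBound.mono (hpos : ∀ x, (h x).IsPositive) (hf : FormBound h f a) (hab : a ≤ b) :
    FormBound h f b := fun x u v =>
  (hf x u v).trans (mul_le_mul_of_nonneg_right hab
    (by linarith [quad_nonneg hpos u, quad_nonneg hpos v]))

theorem FormBound.eq_zero (hf : FormBound h f 0) : f = 0 :=
  funext fun x => clm_ext_inner fun u v => by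
  have := hf x u v
  rw [zero_mul, norm_le_zero_iff] at this
  simpa using this

theorem FormBound.eq_zero_of_forall (hf : ∀ ε > 0, FormBound h f ε) : f = 0 := by
  refine FormBound.eq_zero (h := h) fun x u v => ?_
  have h1 : Tendsto (fun ε : ℝ => ε * ((quad h u + quad h v) / 2)) (𝓝[>] 0)
      (𝓝 (0 * ((quad h u + quad h v) / 2))) :=
    ((continuous_id.mul continuous_const).tendsto _).mono_left nhdsWithin_le_nhds
  exact ge_of_tendsto h1 (by filter_upwards [self_mem_nhdsWithin] with ε hε using hf ε hε x u v)

theorem FormBound.of_tendsto {ι : Type*} {l : Filter ι} [l.NeBot] {F : ι → ∀ x, E x →L[ℂ] E x}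
    (hF : ∀ᶠ i in l, FormBound h (F i) a) (hlim : ∀ x, Tendsto (fun i => F i x) l (𝓝 (f x))) :
    FormBound h f a := fun x u v => by
  have h1 : Tendsto (fun i => ‖inner ℂ v (F i x u)‖) l (𝓝 ‖inner ℂ v (f x u)‖) :=
    (Tendsto.inner tendsto_const_nhds
      (((ContinuousLinearMap.apply ℂ (E x) u).continuous.tendsto _).comp (hlim x))).norm
  exact le_of_tendsto h1 (hF.mono fun i hi => hi x u v)

/-- The identification of two fibres over equal base points. -/
def castFib {x x' : X} (e : x = x') : E x →L[ℂ] E x' :=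
  e ▸ ContinuousLinearMap.id ℂ (E x)

theorem inner_transportEnd {x x' : X} (e : x = x') (T : E x →L[ℂ] E x) (u v : E x') :
    inner ℂ v (transportEnd e T u) = inner ℂ (castFib e.symm v) (T (castFib e.symm u)) := by
  subst e; rfl

theorem section_ext {G Y : Type*} [Group G] [MulAction G Y] {E : Base G Y → Type*}
    [∀ x, NormedAddCommGroup (E x)] [∀ x, InnerProductSpace ℂ (E x)] {f g : ∀ x, E x →L[ℂ] E x}
    (hfg : ∀ (y : Y) (u v : E (proj G y)), inner ℂ v (f _ u) = inner ℂ v (g _ u)) : f = g := by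
  funext x
  induction x using Quotient.inductionOn with
  | h y => exact clm_ext_inner fun u v => hfg y u v

end Forms

section TransferForms

variable {G Y : Type*} [Group G] [MulAction G Y] [MetricSpace Y] {D : Dilation G Y}
  {E : Base G Y → Type*} [∀ x, NormedAddCommGroup (E x)] [∀ x, InnerProductSpace ℂ (E x)]
  {m : ∀ x, E (D.baseMap x) →L[ℂ] E x}
  {h f g : ∀ x, E x →L[ℂ] E x} {a : ℝ}

variable (D m) in
/-- The map `m (p ψ_i y)`, seen as a map from the fibre over `p y = r (p ψ_i y)` to the fibre over
`p ψ_i y`. -/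
def stepMap (i : Fin D.q) (y : Y) : E (proj G y) →L[ℂ] E (proj G (D.branch i y)) :=
  (m (proj G (D.branch i y))).comp (castFib (D.baseMap_branch i y).symm)

/-- Read as an action on sesquilinear forms, the transfer operator is a sum of pull-backs; the
Hermitian metric does not enter. -/
theorem inner_transfer_proj [∀ x, CompleteSpace (E x)] (f : ∀ x, E x →L[ℂ] E x) (y : Y)
    (u v : E (proj G y)) :
    inner ℂ v (transfer D m f (proj G y) u) =
      ∑ i, inner ℂ (stepMap D m i y v) (f _ (stepMap D m i y u)) := by
  rw [transfer_proj, transferSum, sum_apply, inner_sum]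
  refine Finset.sum_congr rfl fun i _ => ?_
  rw [inner_transportEnd, pullEnd, ContinuousLinearMap.comp_apply,
    ContinuousLinearMap.adjoint_inner_right]
  rfl

variable (D m) in
/-- The transfer operator as a linear endomorphism of the space of all sections of `End ξ`. -/
def transferL [∀ x, CompleteSpace (E x)] :
    (∀ x, E x →L[ℂ] E x) →ₗ[ℂ] (∀ x, E x →L[ℂ] E x) where
  toFun := transfer D m
  map_add' f g := section_ext fun y u v => by
    simp [inner_transfer_proj, Finset.sum_add_distrib]
  map_smul' c f := section_ext fun y u v => by
    simp [inner_transfer_proj, Finset.mul_sum]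

theorem transferL_apply [∀ x, CompleteSpace (E x)] (f : ∀ x, E x →L[ℂ] E x) :
    transferL D m f = transfer D m f := rfl

theorem transferL_pow_apply [∀ x, CompleteSpace (E x)] (j : ℕ) (f : ∀ x, E x →L[ℂ] E x) :
    (transferL D m ^ j) f = (transfer D m)^[j] f := by
  rw [Module.End.pow_apply]; rfl

theorem transfer_starSec [∀ x, CompleteSpace (E x)] (f : ∀ x, E x →L[ℂ] E x) :
    transfer D m (starSec f) = starSec (transfer D m f) := section_ext fun y u v => by
  rw [starSec, ContinuousLinearMap.adjoint_inner_right, inner_transfer_proj,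
    ← inner_conj_symm, inner_transfer_proj, map_sum]
  simp only [inner_conj_symm, starSec, ContinuousLinearMap.adjoint_inner_right]

theorem sum_quad_stepMap [∀ x, CompleteSpace (E x)] (hh : transfer D m h = h) (y : Y)
    (u : E (proj G y)) : ∑ i, quad h (stepMap D m i y u) = quad h u := by
  unfold quad
  rw [← Complex.re_sum, ← inner_transfer_proj, hh]

theorem FormBound.transfer [∀ x, CompleteSpace (E x)] (hh : transfer D m h = h)
    (hf : FormBound h f a) : FormBound h (transfer D m f) a := fun x => by
  induction x using Quotient.inductionOn with
  | h y =>
    intro u v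
    change E (proj G y) at u v
    calc ‖inner ℂ v (MatrixTransfer.transfer D m f (proj G y) u)‖
        ≤ ∑ i, a * ((quad h (stepMap D m i y u) + quad h (stepMap D m i y v)) / 2) := by
          rw [inner_transfer_proj]
          exact (norm_sum_le _ _).trans (Finset.sum_le_sum fun i _ => hf _ _ _)
      _ = a * ((quad h u + quad h v) / 2) := by
          rw [← Finset.mul_sum, ← Finset.sum_div, Finset.sum_add_distrib, sum_quad_stepMap hh,
            sum_quad_stepMap hh]

theorem FormBound.transfer_iterate [∀ x, CompleteSpace (E x)]
    (hh : MatrixTransfer.transfer D m h = h) (hf : FormBound h f a) (j : ℕ) :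
    FormBound h ((MatrixTransfer.transfer D m)^[j] f) a := by
  induction j with
  | zero => exact hf
  | succ j ih => rw [Function.iterate_succ_apply']; exact ih.transfer hh

end TransferForms

/-! ### Matrices of sections in local trivializations -/

section Frames

variable {X : Type*} [TopologicalSpace X] {F : Type*} [NormedAddCommGroup F]
  [InnerProductSpace ℂ F] [CompleteSpace F]
  {E : X → Type*} [∀ x, NormedAddCommGroup (E x)] [∀ x, InnerProductSpace ℂ (E x)]
  [∀ x, CompleteSpace (E x)] [TopologicalSpace (TotalSpace F E)] [FiberBundle F E]
  (e : Trivialization F (π F E)) [e.IsLinear ℂ]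

/-- The matrix, in a local trivialization `e`, of the sesquilinear form `(v, u) ↦ ⟨v, f u⟩`. -/
def gramOp (f : ∀ x, E x →L[ℂ] E x) (x : X) : F →L[ℂ] F :=
  (ContinuousLinearMap.adjoint (e.symmL ℂ x)).comp ((f x).comp (e.symmL ℂ x))

theorem inner_gramOp (f : ∀ x, E x →L[ℂ] E x) (x : X) (u v : F) :
    inner ℂ v (gramOp e f x u) = inner ℂ (e.symmL ℂ x v) (f x (e.symmL ℂ x u)) := by
  rw [gramOp, ContinuousLinearMap.comp_apply, ContinuousLinearMap.adjoint_inner_right]; rfl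

theorem continuousOn_symmL (u : F) :
    ContinuousOn (fun x => (⟨x, e.symmL ℂ x u⟩ : TotalSpace F E)) e.baseSet :=
  (e.continuousOn_symm.comp (f := fun x => (x, u)) (by fun_prop)
    fun x hx => ⟨hx, Set.mem_univ _⟩).congr fun x hx => by simp [hx]

theorem continuousOn_inner_gramOp (hmetric : IsHermitianMetric F E) {f : ∀ x, E x →L[ℂ] E x}
    (hf : IsBundleEnd F E f) (u v : F) :
    ContinuousOn (fun x => inner ℂ v (gramOp e f x u)) e.baseSet := by
  simp only [inner_gramOp]
  have h1 : ContinuousOn (fun x => (⟨x, (e.symmL ℂ x v, f x (e.symmL ℂ x u))⟩ :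
      TotalSpace (F × F) (E ×ᵇ E))) e.baseSet := by
    rw [(FiberBundle.Prod.isInducing_diag F E F E).continuousOn_iff]
    exact (continuousOn_symmL e v).prodMk (hf.comp_continuousOn (continuousOn_symmL e u))
  exact (show Continuous _ from hmetric).comp_continuousOn h1

theorem continuousOn_gramOp [FiniteDimensional ℂ F] (hmetric : IsHermitianMetric F E)
    {f : ∀ x, E x →L[ℂ] E x} (hf : IsBundleEnd F E f) : ContinuousOn (gramOp e f) e.baseSet := by
  rw [continuousOn_clm_apply]
  intro u
  have h1 : (fun x => gramOp e f x u) = fun x => ∑ i, inner ℂ (stdOrthonormalBasis ℂ F i)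
      (gramOp e f x u) • stdOrthonormalBasis ℂ F i := by
    funext x
    exact ((stdOrthonormalBasis ℂ F).sum_repr' _).symm
  rw [h1]
  exact continuousOn_finsetSum _ fun i _ =>
    (continuousOn_inner_gramOp e hmetric hf u _).smul continuousOn_const

theorem continuousAt_gramOp_of_inner [FiniteDimensional ℂ F] {f : ∀ x, E x →L[ℂ] E x} {x₀ : X}
    (hf : ∀ u v, ContinuousAt (fun x => inner ℂ v (gramOp e f x u)) x₀) :
    ContinuousAt (gramOp e f) x₀ := by
  rw [continuousAt_clm_apply]
  intro u
  have h1 : (fun x => gramOp e f x u) = fun x => ∑ i, inner ℂ (stdOrthonormalBasis ℂ F i)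
      (gramOp e f x u) • stdOrthonormalBasis ℂ F i := by
    funext x
    exact ((stdOrthonormalBasis ℂ F).sum_repr' _).symm
  rw [h1]
  exact tendsto_finsetSum _ fun i _ => (hf u _).smul continuousAt_const

/-- The matrix of `f` in a local trivialization `e`. -/
def matOp (f : ∀ x, E x →L[ℂ] E x) (x : X) : F →L[ℂ] F :=
  (e.continuousLinearMapAt ℂ x).comp ((f x).comp (e.symmL ℂ x))

/-- The Gram matrix of the Hermitian metric converts the matrix of `f` into that of its form. -/
theorem gramOp_eq_mul {x : X} (hx : x ∈ e.baseSet) (f : ∀ x, E x →L[ℂ] E x) :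
    gramOp e f x = gramOp e (fun x => (1 : E x →L[ℂ] E x)) x * matOp e f x := by
  ext u
  simp [gramOp, matOp, hx]

theorem matOp_mul {x : X} (hx : x ∈ e.baseSet) (f g : ∀ x, E x →L[ℂ] E x) :
    matOp e (fun x => f x * g x) x = matOp e f x * matOp e g x := by
  ext u
  simp [matOp, hx]

theorem matOp_one {x : X} (hx : x ∈ e.baseSet) :
    matOp e (fun x => (1 : E x →L[ℂ] E x)) x = 1 := by
  ext u
  simp [matOp, hx]

theorem symmL_injective {x : X} (hx : x ∈ e.baseSet) : Function.Injective (e.symmL ℂ x) :=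
  Function.LeftInverse.injective (e.continuousLinearMapAt_symmL (R := ℂ) hx)

theorem isUnit_gramOp_one [FiniteDimensional ℂ F] {x : X} (hx : x ∈ e.baseSet) :
    IsUnit (gramOp e (fun x => (1 : E x →L[ℂ] E x)) x) := by
  have hinj : Function.Injective (gramOp e (fun x => (1 : E x →L[ℂ] E x)) x) := by
    rw [injective_iff_map_eq_zero]
    intro u hu
    have h1 : inner ℂ u (gramOp e (fun x => (1 : E x →L[ℂ] E x)) x u) =
      inner ℂ (e.symmL ℂ x u) (e.symmL ℂ x u) := inner_gramOp e _ x u u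
    rw [hu, inner_zero_right, eq_comm, inner_self_eq_zero] at h1
    exact (map_eq_zero_iff _ (symmL_injective e hx)).1 h1
  rw [ContinuousLinearMap.isUnit_iff_bijective]
  exact ⟨hinj, (LinearMap.injective_iff_surjective (f := (gramOp e _ x).toLinearMap)).1 hinj⟩

theorem continuousAt_matOp_of_gramOp [FiniteDimensional ℂ F] (hmetric : IsHermitianMetric F E)
    {f : ∀ x, E x →L[ℂ] E x} {x₀ : X} (hx : x₀ ∈ e.baseSet) (hf : ContinuousAt (gramOp e f) x₀) :
    ContinuousAt (matOp e f) x₀ := by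
  have hone : IsBundleEnd F E (fun x => (1 : E x →L[ℂ] E x)) := continuous_id
  have h1 : ContinuousAt (gramOp e (fun x => (1 : E x →L[ℂ] E x))) x₀ :=
    (continuousOn_gramOp e hmetric hone).continuousAt (e.open_baseSet.mem_nhds hx)
  obtain ⟨w, hw⟩ := isUnit_gramOp_one e hx
  have h2 : ContinuousAt Ring.inverse (gramOp e (fun x => (1 : E x →L[ℂ] E x)) x₀) :=
    hw ▸ NormedRing.inverse_continuousAt w
  refine ((ContinuousAt.comp h2 h1).mul hf).congr ?_
  filter_upwards [e.open_baseSet.mem_nhds hx] with x hx'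
  change Ring.inverse (gramOp e (fun x => (1 : E x →L[ℂ] E x)) x) * gramOp e f x = _
  rw [gramOp_eq_mul e hx' f, Ring.inverse_mul_cancel_left _ _ (isUnit_gramOp_one e hx')]

end Frames

section Continuity

variable {X : Type*} [TopologicalSpace X] {F : Type*} [NormedAddCommGroup F]
  [InnerProductSpace ℂ F] [CompleteSpace F] [FiniteDimensional ℂ F]
  {E : X → Type*} [∀ x, NormedAddCommGroup (E x)] [∀ x, InnerProductSpace ℂ (E x)]
  [∀ x, CompleteSpace (E x)] [TopologicalSpace (TotalSpace F E)] [FiberBundle F E]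

theorem isBundleEnd_of_continuousAt_matOp {f : ∀ x, E x →L[ℂ] E x}
    (hf : ∀ x₀, ∃ (e : Trivialization F (π F E)) (_ : e.IsLinear ℂ), x₀ ∈ e.baseSet ∧
      ContinuousAt (matOp e f) x₀) : IsBundleEnd F E f := by
  refine continuous_iff_continuousAt.2 fun v₀ => ?_
  obtain ⟨e, he, hx, hc⟩ := hf v₀.1
  have hsrc : v₀ ∈ e.source := e.mem_source.2 hx
  have h1 : ContinuousAt e v₀ := e.continuousAt hsrc
  have h2 : ContinuousAt (fun v : TotalSpace F E => v.1) v₀ := e.continuousAt_proj hsrc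
  have h3 : ContinuousAt (fun v : TotalSpace F E => matOp e f v.1 (e v).2) v₀ :=
    (ContinuousAt.comp (f := fun v : TotalSpace F E => v.1) hc h2).clm_apply h1.snd
  have h4 : ContinuousAt e.toOpenPartialHomeomorph.symm (v₀.1, matOp e f v₀.1 (e v₀).2) :=
    e.toOpenPartialHomeomorph.symm.continuousAt (by
      change _ ∈ e.target
      rw [e.target_eq]; exact ⟨hx, Set.mem_univ _⟩)
  refine (ContinuousAt.comp
    (f := fun v : TotalSpace F E => (v.1, matOp e f v.1 (e v).2)) h4 (h2.prodMk h3)).congr ?_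
  filter_upwards [e.open_source.mem_nhds hsrc] with v hv
  have hv' : v.1 ∈ e.baseSet := e.mem_source.1 hv
  have h5 : (e v).2 = e.continuousLinearMapAt ℂ v.1 v.2 :=
    (e.continuousLinearMapAt_apply_of_mem (R := ℂ) hv' v.2).symm
  change e.toOpenPartialHomeomorph.symm (v.1, matOp e f v.1 (e v).2) = _
  rw [h5, matOp, ContinuousLinearMap.comp_apply, ContinuousLinearMap.comp_apply,
    e.symmL_continuousLinearMapAt hv', e.continuousLinearMapAt_apply_of_mem (R := ℂ) hv']
  have h6 : ((v.1, (e (⟨v.1, f v.1 v.2⟩ : TotalSpace F E)).2) : X × F) = e ⟨v.1, f v.1 v.2⟩ :=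
    Prod.ext (e.coe_fst (x := (⟨v.1, f v.1 v.2⟩ : TotalSpace F E)) (e.mem_source.2 hv')).symm rfl
  rw [h6]
  exact e.toOpenPartialHomeomorph.left_inv (e.mem_source.2 hv')

theorem IsBundleEnd.continuousAt_matOp (hmetric : IsHermitianMetric F E)
    {f : ∀ x, E x →L[ℂ] E x} (hf : IsBundleEnd F E f) (e : Trivialization F (π F E))
    [e.IsLinear ℂ] {x : X} (hx : x ∈ e.baseSet) : ContinuousAt (matOp e f) x :=
  continuousAt_matOp_of_gramOp e hmetric hx
    ((continuousOn_gramOp e hmetric hf).continuousAt (e.open_baseSet.mem_nhds hx))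

theorem IsBundleEnd.mul {f g : ∀ x, E x →L[ℂ] E x} (hf : IsBundleEnd F E f)
    (hg : IsBundleEnd F E g) : IsBundleEnd F E (fun x => f x * g x) :=
  Continuous.comp (g := fun v : TotalSpace F E => (⟨v.1, f v.1 v.2⟩ : TotalSpace F E)) hf hg

variable [VectorBundle ℂ F E]

theorem IsBundleEnd.inverse (hmetric : IsHermitianMetric F E) {f : ∀ x, E x →L[ℂ] E x}
    (hf : IsBundleEnd F E f) (hu : ∀ x, IsUnit (f x)) :
    IsBundleEnd F E (fun x => Ring.inverse (f x)) := by
  refine isBundleEnd_of_continuousAt_matOp fun x₀ => ⟨trivializationAt F E x₀, inferInstance,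
    mem_baseSet_trivializationAt F E x₀, ?_⟩
  set e := trivializationAt F E x₀
  have hx : x₀ ∈ e.baseSet := mem_baseSet_trivializationAt F E x₀
  have h1 : ∀ x ∈ e.baseSet, matOp e f x * matOp e (fun x => Ring.inverse (f x)) x = 1 ∧
      matOp e (fun x => Ring.inverse (f x)) x * matOp e f x = 1 := fun x hx => by
    rw [← matOp_mul e hx, ← matOp_mul e hx, ← matOp_one e hx]
    simp only [Ring.mul_inverse_cancel _ (hu _), Ring.inverse_mul_cancel _ (hu _), and_self]
  have h2 : ∀ x ∈ e.baseSet, Ring.inverse (matOp e f x) =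
      matOp e (fun x => Ring.inverse (f x)) x := fun x hx =>
    Ring.inverse_unit ⟨_, _, (h1 x hx).1, (h1 x hx).2⟩
  have h3 : ContinuousAt Ring.inverse (matOp e f x₀) :=
    NormedRing.inverse_continuousAt ⟨_, _, (h1 x₀ hx).1, (h1 x₀ hx).2⟩
  refine (ContinuousAt.comp h3 (hf.continuousAt_matOp hmetric e hx)).congr ?_
  filter_upwards [e.open_baseSet.mem_nhds hx] with x hx'
  exact h2 x hx'

end Continuity

/-! ### Finite covers by charts -/

section Cover

variable {G Y : Type*} [Group G] [MulAction G Y] [MetricSpace Y]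

theorem continuous_proj : Continuous (proj G : Y → Base G Y) := continuous_quotient_mk'

theorem isOpenMap_proj [IsIsometricSMul G Y] : IsOpenMap (proj G : Y → Base G Y) :=
  isOpenMap_quotient_mk'_mul

theorem exists_finite_centers [IsIsometricSMul G Y] [CompactSpace (Base G Y)] (ρ : Y → ℝ)
    (hρ : ∀ y, 0 < ρ y) :
    ∃ t : Finset Y, ∀ x : Base G Y, ∃ c ∈ t, ∃ y ∈ Metric.ball c (ρ c), proj G y = x := by
  obtain ⟨t, ht⟩ := isCompact_univ.elim_finite_subcover
    (fun c : Y => proj G '' Metric.ball c (ρ c))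
    (fun c => isOpenMap_proj _ Metric.isOpen_ball) (fun x _ => by
      induction x using Quotient.inductionOn with
      | h y => exact Set.mem_iUnion.2 ⟨y, y, Metric.mem_ball_self (hρ y), rfl⟩)
  refine ⟨t, fun x => ?_⟩
  obtain ⟨c, hc, y, hy, hyx⟩ := Set.mem_iUnion₂.1 (ht (Set.mem_univ x))
  exact ⟨c, hc, y, hy, hyx⟩

variable {F : Type*} [NormedAddCommGroup F] [InnerProductSpace ℂ F] [CompleteSpace F]
  [FiniteDimensional ℂ F]
  {E : Base G Y → Type*} [∀ x, NormedAddCommGroup (E x)] [∀ x, InnerProductSpace ℂ (E x)]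
  [∀ x, CompleteSpace (E x)] [TopologicalSpace (TotalSpace F E)] [FiberBundle F E]
  [VectorBundle ℂ F E]

instance LipschitzAtlas.isLinear_triv (𝒜 : LipschitzAtlas F E) (i : 𝒜.ι) :
    (𝒜.triv i).IsLinear ℂ := 𝒜.linear i

/-- Finitely many balls of `X̃` whose images cover `X`, such that the concentric closed balls of
twice the radius are compact and lie over the domain of a chart. -/
structure FiniteCover (𝒜 : LipschitzAtlas F E) where
  /-- the centers of the balls -/
  centers : Finset Y
  /-- the charts -/
  chart : Y → 𝒜.ι
  /-- the radii -/
  rad : Y → ℝ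
  rad_pos : ∀ c, 0 < rad c
  isCompact : ∀ c, IsCompact (Metric.closedBall c (2 * rad c))
  subset : ∀ c, ∀ y ∈ Metric.closedBall c (2 * rad c), proj G y ∈ (𝒜.triv (chart c)).baseSet
  cover : ∀ x : Base G Y, ∃ c ∈ centers, ∃ y ∈ Metric.ball c (rad c), proj G y = x

theorem exists_finiteCover [IsIsometricSMul G Y] [CompactSpace (Base G Y)]
    [LocallyCompactSpace Y] (𝒜 : LipschitzAtlas F E) : Nonempty (FiniteCover 𝒜) := by
  have h1 : ∀ c : Y, ∃ (i : 𝒜.ι) (r : ℝ), 0 < r ∧ IsCompact (Metric.closedBall c (2 * r)) ∧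
      ∀ y ∈ Metric.closedBall c (2 * r), proj G y ∈ (𝒜.triv i).baseSet := by
    intro c
    obtain ⟨i, hi⟩ := 𝒜.cover (proj G c)
    have h2 : (proj G : Y → Base G Y) ⁻¹' (𝒜.triv i).baseSet ∈ 𝓝 c :=
      continuous_proj.continuousAt.preimage_mem_nhds ((𝒜.triv i).open_baseSet.mem_nhds hi)
    obtain ⟨K, hK, hKs, hKc⟩ := LocallyCompactSpace.local_compact_nhds c _ h2
    obtain ⟨r, hr, hrK⟩ := Metric.nhds_basis_closedBall.mem_iff.1 hK
    have h3 : 2 * (r / 2) = r := by ring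
    refine ⟨i, r / 2, by positivity, ?_, ?_⟩ <;> rw [h3]
    · exact hKc.of_isClosed_subset Metric.isClosed_closedBall hrK
    · exact fun y hy => hKs (hrK hy)
  choose chart rad hpos hcpt hsub using h1
  obtain ⟨t, ht⟩ := exists_finite_centers (G := G) rad hpos
  exact ⟨⟨t, chart, rad, hpos, hcpt, hsub, ht⟩⟩

namespace FiniteCover

variable {𝒜 : LipschitzAtlas F E} (𝒞 : FiniteCover 𝒜)

/-- The chart attached to a center. -/
abbrev triv (c : Y) : Trivialization F (π F E) := 𝒜.triv (𝒞.chart c)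

/-- The image in `X` of the ball around `c`. -/
def small (c : Y) : Set (Base G Y) := proj G '' Metric.ball c (𝒞.rad c)

/-- The image in `X` of the closed ball of twice the radius around `c`. -/
def large (c : Y) : Set (Base G Y) := proj G '' Metric.closedBall c (2 * 𝒞.rad c)

theorem exists_mem_small (x : Base G Y) : ∃ c ∈ 𝒞.centers, x ∈ 𝒞.small c := 𝒞.cover x

theorem large_subset (c : Y) : 𝒞.large c ⊆ (𝒞.triv c).baseSet := by
  rintro _ ⟨y, hy, rfl⟩
  exact 𝒞.subset c y hy

theorem isCompact_large (c : Y) : IsCompact (𝒞.large c) :=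
  (𝒞.isCompact c).image continuous_proj

theorem mem_large_of_dist_lt [IsIsometricSMul G Y] {c x y : Y} (hx : proj G x ∈ 𝒞.small c)
    (hxy : dist x y < 𝒞.rad c) : proj G y ∈ 𝒞.large c := by
  obtain ⟨x', hx', hp⟩ := hx
  obtain ⟨g, rfl⟩ : ∃ g : G, g • x = x' := Quotient.exact hp
  refine ⟨g • y, ?_, proj_smul g y⟩
  rw [Metric.mem_closedBall]
  have h1 := dist_triangle (g • y) (g • x) c
  rw [dist_smul, dist_comm y x] at h1
  rw [Metric.mem_ball] at hx'
  linarith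

theorem small_subset_large [IsIsometricSMul G Y] (c : Y) : 𝒞.small c ⊆ 𝒞.large c :=
  Set.image_mono ((Metric.ball_subset_closedBall).trans
    (Metric.closedBall_subset_closedBall (by linarith [𝒞.rad_pos c])))

theorem exists_le_rad : ∃ δ > 0, ∀ c ∈ 𝒞.centers, δ ≤ 𝒞.rad c := by
  have h1 : ∀ᶠ δ in 𝓝[>] (0 : ℝ), ∀ c ∈ 𝒞.centers, δ ≤ 𝒞.rad c :=
    (eventually_all_finset 𝒞.centers).2 fun c _ =>
      mem_nhdsWithin_of_mem_nhds (Iic_mem_nhds (𝒞.rad_pos c))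
  obtain ⟨δ, h2, h3⟩ := (h1.and self_mem_nhdsWithin).exists
  exact ⟨δ, h3, h2⟩

/-- A continuous function on the domain of a chart is uniformly continuous for the metric of `X̃`
near the image of the corresponding ball, although `X̃` itself need not be compact. -/
theorem uniform_continuity [IsIsometricSMul G Y] {Z : Type*} [PseudoMetricSpace Z] (c : Y)
    {φ : Base G Y → Z} (hφ : ContinuousOn φ (𝒞.triv c).baseSet) {ε : ℝ} (hε : 0 < ε) :
    ∃ η > 0, ∀ x y : Y, proj G x ∈ 𝒞.small c → dist x y < η →
      dist (φ (proj G y)) (φ (proj G x)) < ε := by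
  have h1 : ContinuousOn (fun y => φ (proj G y)) (Metric.closedBall c (2 * 𝒞.rad c)) :=
    hφ.comp continuous_proj.continuousOn (𝒞.subset c)
  have h2 := (𝒞.isCompact c).uniformContinuousOn_of_continuous h1
  obtain ⟨η, hη, h3⟩ := Metric.uniformContinuousOn_iff.1 h2 ε hε
  refine ⟨min η (𝒞.rad c), lt_min hη (𝒞.rad_pos c), fun x y hx hxy => ?_⟩
  obtain ⟨x', hx', hp⟩ := hx
  obtain ⟨g, rfl⟩ : ∃ g : G, g • x = x' := Quotient.exact hp
  rw [Metric.mem_ball] at hx'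
  have h4 := dist_triangle (g • y) (g • x) c
  rw [dist_smul, dist_comm y x] at h4
  have h5 := h3 (g • y) (Metric.mem_closedBall.2 (by linarith [hxy.trans_le (min_le_right _ _)]))
    (g • x) (Metric.mem_closedBall.2 (by linarith [𝒞.rad_pos c]))
    (by rw [dist_smul, dist_comm]; exact hxy.trans_le (min_le_left _ _))
  simpa only [proj_smul] using h5

theorem exists_norm_gramOp_le (hmetric : IsHermitianMetric F E) {f : ∀ x, E x →L[ℂ] E x}
    (hf : IsBundleEnd F E f) :
    ∃ C > 0, ∀ c ∈ 𝒞.centers, ∀ x ∈ 𝒞.large c, ‖gramOp (𝒞.triv c) f x‖ ≤ C := by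
  have h1 : ∀ᶠ C : ℝ in atTop, ∀ c ∈ 𝒞.centers, ∀ x ∈ 𝒞.large c,
      ‖gramOp (𝒞.triv c) f x‖ ≤ C := by
    refine (eventually_all_finset 𝒞.centers).2 fun c _ => ?_
    obtain ⟨C, hC⟩ := (𝒞.isCompact_large c).exists_bound_of_continuousOn
      ((continuousOn_gramOp (𝒞.triv c) hmetric hf).mono (𝒞.large_subset c))
    filter_upwards [eventually_ge_atTop C] with C' hC' x hx using (hC x hx).trans hC'
  obtain ⟨C, h2, h3⟩ := (h1.and (eventually_gt_atTop 0)).exists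
  exact ⟨C, h3, h2⟩

theorem quad_symmL (c : Y) (f : ∀ x, E x →L[ℂ] E x) (x : Base G Y) (u : F) :
    quad f ((𝒞.triv c).symmL ℂ x u) = (inner ℂ u (gramOp (𝒞.triv c) f x u)).re := by
  rw [quad, inner_gramOp]

theorem exists_sq_norm_le_quad (hmetric : IsHermitianMetric F E) {f : ∀ x, E x →L[ℂ] E x}
    (hf : IsBundleEnd F E f) (hpos : ∀ x (u : E x), u ≠ 0 → 0 < quad f u) :
    ∃ C > 0, ∀ c ∈ 𝒞.centers, ∀ x ∈ 𝒞.large c, ∀ u : F,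
      ‖u‖ ^ 2 ≤ C * quad f ((𝒞.triv c).symmL ℂ x u) := by
  have h1 : ∀ᶠ C : ℝ in atTop, ∀ c ∈ 𝒞.centers, ∀ x ∈ 𝒞.large c, ∀ u : F,
      ‖u‖ ^ 2 ≤ C * quad f ((𝒞.triv c).symmL ℂ x u) := by
    refine (eventually_all_finset 𝒞.centers).2 fun c _ => ?_
    have hS : IsCompact (𝒞.large c ×ˢ Metric.sphere (0 : F) 1) :=
      have := FiniteDimensional.proper ℂ F
      (𝒞.isCompact_large c).prod (isCompact_sphere 0 1)
    have hcont : ContinuousOn (fun p : Base G Y × F =>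
        (inner ℂ p.2 (gramOp (𝒞.triv c) f p.1 p.2)).re)
        (𝒞.large c ×ˢ Metric.sphere (0 : F) 1) := by
      have h2 : ContinuousOn (fun p : Base G Y × F => gramOp (𝒞.triv c) f p.1)
          (𝒞.large c ×ˢ Metric.sphere (0 : F) 1) :=
        ((continuousOn_gramOp (𝒞.triv c) hmetric hf).mono (𝒞.large_subset c)).comp
          continuousOn_fst fun p hp => hp.1
      exact Complex.continuous_re.comp_continuousOn
        (continuousOn_snd.inner (h2.clm_apply continuousOn_snd))
    obtain ⟨κ, hκ, h3⟩ := hS.exists_forall_le' hcont (a := 0) fun p hp => by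
      rw [← quad_symmL]
      refine hpos _ _ fun h0 => ?_
      have h4 := (map_eq_zero_iff _ (symmL_injective (𝒞.triv c) (𝒞.large_subset c hp.1))).1 h0
      have h5 := hp.2
      rw [mem_sphere_zero_iff_norm, h4, norm_zero] at h5
      exact zero_ne_one h5
    filter_upwards [eventually_ge_atTop κ⁻¹] with C hC x hx u
    rcases eq_or_ne u 0 with rfl | hu
    · simp [quad]
    have hu' : ‖u‖ ≠ 0 := norm_ne_zero_iff.2 hu
    have h4 := h3 (x, ((‖u‖⁻¹ : ℝ) : ℂ) • u) ⟨hx, by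
      rw [mem_sphere_zero_iff_norm, norm_smul, Complex.norm_real, norm_inv, norm_norm,
        inv_mul_cancel₀ hu']⟩
    rw [← quad_symmL, map_smul, quad_smul, Complex.norm_real, norm_inv, norm_norm, inv_pow,
      inv_mul_eq_div, le_div_iff₀ (by positivity)] at h4
    have h6 : 0 ≤ quad f ((𝒞.triv c).symmL ℂ x u) := le_trans (by positivity) h4
    calc ‖u‖ ^ 2 = κ⁻¹ * (κ * ‖u‖ ^ 2) := by field_simp
      _ ≤ κ⁻¹ * quad f ((𝒞.triv c).symmL ℂ x u) := by gcongr
      _ ≤ C * quad f ((𝒞.triv c).symmL ℂ x u) := by gcongr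
  obtain ⟨C, h2, h3⟩ := (h1.and (eventually_gt_atTop 0)).exists
  exact ⟨C, h3, h2⟩

end FiniteCover

end Cover

/-! ### Moduli of continuity -/

theorem opNorm_le_of_norm_inner_le {V : Type*} [NormedAddCommGroup V] [InnerProductSpace ℂ V]
    {T : V →L[ℂ] V} {c : ℝ} (hc : 0 ≤ c)
    (hT : ∀ u v, ‖inner ℂ v (T u)‖ ≤ c * ((‖u‖ ^ 2 + ‖v‖ ^ 2) / 2)) : ‖T‖ ≤ c := by
  refine T.opNorm_le_bound hc fun u => ?_
  rcases eq_or_ne u 0 with rfl | hu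
  · simp
  rcases eq_or_ne (T u) 0 with h0 | h0
  · rw [h0, norm_zero]; positivity
  have hu' : 0 < ‖u‖ := norm_pos_iff.2 hu
  have h0' : 0 < ‖T u‖ := norm_pos_iff.2 h0
  -- the test vector is the multiple of `T u` that is as long as `u`
  have h1 := hT u (((‖u‖ / ‖T u‖ : ℝ) : ℂ) • T u)
  rw [inner_smul_left, norm_mul, RCLike.norm_conj, Complex.norm_real, norm_smul, Complex.norm_real,
    norm_div, norm_norm, norm_norm, div_mul_cancel₀ _ h0'.ne', inner_self_eq_norm_sq_to_K,
    norm_pow, RCLike.norm_ofReal, abs_norm] at h1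
  have h2 : ‖u‖ / ‖T u‖ * ‖T u‖ ^ 2 = ‖T u‖ * ‖u‖ := by field_simp
  rw [h2] at h1
  refine le_of_mul_le_mul_right (h1.trans (le_of_eq ?_)) hu'
  ring

section Oscillation

variable {G Y : Type*} [Group G] [MulAction G Y] [MetricSpace Y]
  {F : Type*} [NormedAddCommGroup F] [InnerProductSpace ℂ F] [CompleteSpace F]
  [FiniteDimensional ℂ F]
  {E : Base G Y → Type*} [∀ x, NormedAddCommGroup (E x)] [∀ x, InnerProductSpace ℂ (E x)]
  [∀ x, CompleteSpace (E x)] [TopologicalSpace (TotalSpace F E)] [FiberBundle F E]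
  [VectorBundle ℂ F E] {𝒜 : LipschitzAtlas F E}

/-- At distances `t < η` the forms `⟨v, f u⟩`, read in the charts of the cover, vary by at most
`ε + L t`, measured against `h` at the first of the two points. -/
def OscBound (𝒞 : FiniteCover 𝒜) (h f : ∀ x, E x →L[ℂ] E x) (η ε L : ℝ) : Prop :=
  ∀ c ∈ 𝒞.centers, ∀ x y : Y, proj G x ∈ 𝒞.small c → dist x y < η → ∀ u v : F,
    ‖inner ℂ v (gramOp (𝒞.triv c) f (proj G y) u) -
      inner ℂ v (gramOp (𝒞.triv c) f (proj G x) u)‖ ≤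
    (ε + L * dist x y) * ((quad h ((𝒞.triv c).symmL ℂ (proj G x) u) +
      quad h ((𝒞.triv c).symmL ℂ (proj G x) v)) / 2)

/-- On the large balls of the cover the form of `h` is comparable, with constant `C`, to the
standard form of the chart. -/
def Comparable (𝒞 : FiniteCover 𝒜) (h : ∀ x, E x →L[ℂ] E x) (C : ℝ) : Prop :=
  ∀ c ∈ 𝒞.centers, ∀ x ∈ 𝒞.large c, ∀ u : F,
    ‖u‖ ^ 2 ≤ C * quad h ((𝒞.triv c).symmL ℂ x u) ∧
    quad h ((𝒞.triv c).symmL ℂ x u) ≤ C * ‖u‖ ^ 2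

variable {𝒞 : FiniteCover 𝒜} {h f g : ∀ x, E x →L[ℂ] E x}

theorem exists_comparable (𝒞 : FiniteCover 𝒜) (hmetric : IsHermitianMetric F E)
    (hend : IsBundleEnd F E h) (hpos : ∀ x (u : E x), u ≠ 0 → 0 < quad h u) :
    ∃ C > 0, Comparable 𝒞 h C := by
  obtain ⟨C₁, hC₁, h1⟩ := 𝒞.exists_sq_norm_le_quad hmetric hend hpos
  obtain ⟨C₂, hC₂, h2⟩ := 𝒞.exists_norm_gramOp_le hmetric hend
  refine ⟨max C₁ C₂, lt_max_of_lt_left hC₁, fun c hc x hx u => ?_⟩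
  have h3 := h1 c hc x hx u
  have h4 : quad h ((𝒞.triv c).symmL ℂ x u) ≤ C₂ * ‖u‖ ^ 2 := by
    rw [𝒞.quad_symmL]
    calc (inner ℂ u (gramOp (𝒞.triv c) h x u)).re
        ≤ ‖u‖ * ‖gramOp (𝒞.triv c) h x u‖ :=
          (Complex.re_le_norm _).trans (norm_inner_le_norm _ _)
      _ ≤ ‖u‖ * (C₂ * ‖u‖) := by
          gcongr; exact ContinuousLinearMap.le_of_opNorm_le _ (h2 c hc x hx) u
      _ = C₂ * ‖u‖ ^ 2 := by ring
  have h5 : 0 ≤ quad h ((𝒞.triv c).symmL ℂ x u) :=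
    nonneg_of_mul_nonneg_right (le_trans (by positivity) h3) hC₁
  exact ⟨h3.trans (by gcongr; exact le_max_left _ _), h4.trans (by gcongr; exact le_max_right _ _)⟩

theorem exists_symmL_eq [IsIsometricSMul G Y] (𝒞 : FiniteCover 𝒜) {c : Y} {x : Base G Y}
    (hx : x ∈ 𝒞.large c) (u : E x) : ∃ u' : F, (𝒞.triv c).symmL ℂ x u' = u :=
  ⟨_, (𝒞.triv c).symmL_continuousLinearMapAt (R := ℂ) (𝒞.large_subset c hx) u⟩

theorem norm_inner_le_of_norm_gramOp_le [IsIsometricSMul G Y] {C N : ℝ} (hN : 0 ≤ N)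
    (hC : Comparable 𝒞 h C) {c : Y} (hc : c ∈ 𝒞.centers) {x : Base G Y} (hx : x ∈ 𝒞.large c)
    (hf : ‖gramOp (𝒞.triv c) f x‖ ≤ N) (u v : E x) :
    ‖inner ℂ v (f x u)‖ ≤ N * C * ((quad h u + quad h v) / 2) := by
  obtain ⟨u, rfl⟩ := exists_symmL_eq 𝒞 hx u
  obtain ⟨v, rfl⟩ := exists_symmL_eq 𝒞 hx v
  rw [← inner_gramOp]
  have h1 := (hC c hc x hx u).1
  have h2 := (hC c hc x hx v).1
  calc ‖inner ℂ v (gramOp (𝒞.triv c) f x u)‖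
      ≤ ‖v‖ * ‖gramOp (𝒞.triv c) f x u‖ := norm_inner_le_norm _ _
    _ ≤ ‖v‖ * (N * ‖u‖) := by
        gcongr; exact ContinuousLinearMap.le_of_opNorm_le _ hf u
    _ ≤ N * ((‖u‖ ^ 2 + ‖v‖ ^ 2) / 2) := by nlinarith [mul_nonneg hN (sq_nonneg (‖u‖ - ‖v‖))]
    _ ≤ N * ((C * quad h ((𝒞.triv c).symmL ℂ x u) + C * quad h ((𝒞.triv c).symmL ℂ x v)) / 2) := by
        gcongr
    _ = _ := by ring

theorem FormBound.norm_gramOp_le {C N : ℝ} (hN : 0 ≤ N) (hC0 : 0 ≤ C) (hC : Comparable 𝒞 h C)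
    (hf : FormBound h f N) {c : Y} (hc : c ∈ 𝒞.centers) {x : Base G Y} (hx : x ∈ 𝒞.large c) :
    ‖gramOp (𝒞.triv c) f x‖ ≤ N * C := by
  refine opNorm_le_of_norm_inner_le (by positivity) fun u v => ?_
  rw [inner_gramOp]
  refine (hf x _ _).trans ?_
  have h1 := (hC c hc x hx u).2
  have h2 := (hC c hc x hx v).2
  calc N * ((quad h ((𝒞.triv c).symmL ℂ x u) + quad h ((𝒞.triv c).symmL ℂ x v)) / 2)
      ≤ N * ((C * ‖u‖ ^ 2 + C * ‖v‖ ^ 2) / 2) := by gcongr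
    _ = _ := by ring

theorem IsBundleEnd.exists_formBound [IsIsometricSMul G Y] (hmetric : IsHermitianMetric F E)
    (hf : IsBundleEnd F E f) {C : ℝ} (hC0 : 0 < C) (hC : Comparable 𝒞 h C) :
    ∃ N ≥ 0, FormBound h f N := by
  obtain ⟨N, hN, h1⟩ := 𝒞.exists_norm_gramOp_le hmetric hf
  refine ⟨N * C, by positivity, fun x u v => ?_⟩
  obtain ⟨c, hc, hx⟩ := 𝒞.exists_mem_small x
  have hx' := 𝒞.small_subset_large c hx
  exact norm_inner_le_of_norm_gramOp_le hN.le hC hc hx' (h1 c hc x hx') u v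

theorem quad_frame_nonneg {C : ℝ} (hC0 : 0 < C) (hC : Comparable 𝒞 h C) {c : Y}
    (hc : c ∈ 𝒞.centers) {x : Base G Y} (hx : x ∈ 𝒞.large c) (u : F) :
    0 ≤ quad h ((𝒞.triv c).symmL ℂ x u) :=
  nonneg_of_mul_nonneg_right (le_trans (by positivity) (hC c hc x hx u).1) hC0

theorem IsBundleEnd.exists_oscBound [IsIsometricSMul G Y] (hmetric : IsHermitianMetric F E)
    (hf : IsBundleEnd F E f) {C : ℝ} (hC0 : 0 < C) (hC : Comparable 𝒞 h C) {ε : ℝ} (hε : 0 < ε) :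
    ∃ η > 0, OscBound 𝒞 h f η ε 0 := by
  have h1 : ∀ᶠ η in 𝓝[>] (0 : ℝ), ∀ c ∈ 𝒞.centers, ∀ x y : Y, proj G x ∈ 𝒞.small c →
      dist x y < η →
      dist (gramOp (𝒞.triv c) f (proj G y)) (gramOp (𝒞.triv c) f (proj G x)) < ε / C := by
    refine (eventually_all_finset 𝒞.centers).2 fun c _ => ?_
    obtain ⟨η, hη, h2⟩ := 𝒞.uniform_continuity c
      (continuousOn_gramOp (𝒞.triv c) hmetric hf) (ε := ε / C) (by positivity)
    filter_upwards [mem_nhdsWithin_of_mem_nhds (Iic_mem_nhds hη)] with η' hη' x y hx hxy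
      using h2 x y hx (hxy.trans_le hη')
  obtain ⟨η, h2, hη⟩ := (h1.and self_mem_nhdsWithin).exists
  refine ⟨η, hη, fun c hc x y hx hxy u v => ?_⟩
  have h3 := (h2 c hc x y hx hxy).le
  rw [dist_eq_norm] at h3
  have hx' := 𝒞.small_subset_large c hx
  have h4 := (hC c hc _ hx' u).1
  have h5 := (hC c hc _ hx' v).1
  rw [← inner_sub_right, ← sub_apply]
  calc ‖inner ℂ v ((gramOp (𝒞.triv c) f (proj G y) - gramOp (𝒞.triv c) f (proj G x)) u)‖
      ≤ ‖v‖ * ‖(gramOp (𝒞.triv c) f (proj G y) - gramOp (𝒞.triv c) f (proj G x)) u‖ :=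
        norm_inner_le_norm _ _
    _ ≤ ‖v‖ * (ε / C * ‖u‖) := by
        gcongr; exact ContinuousLinearMap.le_of_opNorm_le _ h3 u
    _ ≤ ε / C * ((‖u‖ ^ 2 + ‖v‖ ^ 2) / 2) := by
        nlinarith [mul_nonneg (div_pos hε hC0).le (sq_nonneg (‖u‖ - ‖v‖))]
    _ ≤ ε / C * ((C * quad h ((𝒞.triv c).symmL ℂ (proj G x) u) +
          C * quad h ((𝒞.triv c).symmL ℂ (proj G x) v)) / 2) := by gcongr
    _ = _ := by field_simp; ring

/-- Continuity on the total space can be read off from the forms `⟨v, f u⟩`: the Gram matrix of the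
Hermitian metric in a chart is continuous and invertible, so that it can be divided out. -/
theorem isBundleEnd_of_oscBound [IsIsometricSMul G Y] (hmetric : IsHermitianMetric F E)
    (hf : ∀ ε > 0, ∃ η > 0, ∃ L, OscBound 𝒞 h f η ε L) : IsBundleEnd F E f := by
  refine isBundleEnd_of_continuousAt_matOp fun x₀ => ?_
  obtain ⟨c, hc, hx⟩ := 𝒞.exists_mem_small x₀
  have hx' := 𝒞.large_subset c (𝒞.small_subset_large c hx)
  refine ⟨𝒞.triv c, inferInstance, hx', ?_⟩
  refine continuousAt_matOp_of_gramOp _ hmetric hx' (continuousAt_gramOp_of_inner _ fun u v => ?_)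
  obtain ⟨y₀, -, rfl⟩ := id hx
  -- the projection is open, so continuity can be checked upstairs
  have h1 : 𝓝 (proj G y₀) = map (proj G) (𝓝 y₀) :=
    ((isOpenMap_proj (G := G)).map_nhds_eq continuous_proj.continuousAt).symm
  rw [ContinuousAt, h1, tendsto_map'_iff, Metric.tendsto_nhds]
  intro ε hε
  set M := (quad h ((𝒞.triv c).symmL ℂ (proj G y₀) u) +
      quad h ((𝒞.triv c).symmL ℂ (proj G y₀) v)) / 2 with hM
  have h2 : Tendsto (fun t : ℝ => t * M) (𝓝[>] 0) (𝓝 (0 * M)) :=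
    ((continuous_id.mul continuous_const).tendsto _).mono_left nhdsWithin_le_nhds
  rw [zero_mul] at h2
  obtain ⟨t, ht, ht0⟩ := ((h2.eventually_lt_const hε).and self_mem_nhdsWithin).exists
  obtain ⟨η, hη, L, h3⟩ := hf t ht0
  have h4 : Tendsto (fun y : Y => (t + L * dist y₀ y) * M) (𝓝 y₀)
      (𝓝 ((t + L * dist y₀ y₀) * M)) := by
    apply Continuous.tendsto; fun_prop
  rw [dist_self, mul_zero, add_zero] at h4
  filter_upwards [h4.eventually_lt_const ht, Metric.ball_mem_nhds y₀ hη] with y hy hy'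
  rw [dist_eq_norm]
  exact (h3 c hc y₀ y hx (by rwa [dist_comm]) u v).trans_lt hy

theorem OscBound.mono [IsIsometricSMul G Y] {C η ε L η' ε' L' : ℝ} (hC0 : 0 < C)
    (hC : Comparable 𝒞 h C) (hf : OscBound 𝒞 h f η ε L)
    (hη : η' ≤ η) (hε : ε ≤ ε') (hL : L ≤ L') : OscBound 𝒞 h f η' ε' L' := by
  intro c hc x y hx hxy u v
  refine (hf c hc x y hx (hxy.trans_le hη) u v).trans ?_
  have h1 := quad_frame_nonneg hC0 hC hc (𝒞.small_subset_large c hx) u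
  have h2 := quad_frame_nonneg hC0 hC hc (𝒞.small_subset_large c hx) v
  gcongr

theorem gramOp_add (e : Trivialization F (π F E)) [e.IsLinear ℂ] (f g : ∀ x, E x →L[ℂ] E x)
    (x : Base G Y) : gramOp e (f + g) x = gramOp e f x + gramOp e g x := by
  ext u; simp [gramOp]

theorem gramOp_smul (e : Trivialization F (π F E)) [e.IsLinear ℂ] (r : ℂ)
    (f : ∀ x, E x →L[ℂ] E x) (x : Base G Y) : gramOp e (r • f) x = r • gramOp e f x := by
  ext u; simp [gramOp]

theorem OscBound.add {η ε L ε' L' : ℝ} (hf : OscBound 𝒞 h f η ε L)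
    (hg : OscBound 𝒞 h g η ε' L') : OscBound 𝒞 h (f + g) η (ε + ε') (L + L') := by
  intro c hc x y hx hxy u v
  rw [gramOp_add, gramOp_add, add_apply, add_apply, inner_add_right, inner_add_right,
    add_sub_add_comm]
  refine (norm_add_le _ _).trans
    ((add_le_add (hf c hc x y hx hxy u v) (hg c hc x y hx hxy u v)).trans (le_of_eq ?_))
  ring

theorem OscBound.smul {η ε L : ℝ} (hf : OscBound 𝒞 h f η ε L) (r : ℂ) :
    OscBound 𝒞 h (r • f) η (‖r‖ * ε) (‖r‖ * L) := by
  intro c hc x y hx hxy u v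
  rw [gramOp_smul, gramOp_smul, smul_apply, smul_apply, inner_smul_right, inner_smul_right,
    ← mul_sub, norm_mul]
  refine (mul_le_mul_of_nonneg_left (hf c hc x y hx hxy u v) (norm_nonneg r)).trans (le_of_eq ?_)
  ring

theorem OscBound.zero {η : ℝ} : OscBound 𝒞 h (0 : ∀ x, E x →L[ℂ] E x) η 0 0 := by
  intro c hc x y hx hxy u v
  simp [gramOp]

theorem OscBound.sum {ι : Type*} (s : Finset ι) {f : ι → ∀ x, E x →L[ℂ] E x} {η ε L : ℝ}
    (hf : ∀ i ∈ s, OscBound 𝒞 h (f i) η ε L) :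
    OscBound 𝒞 h (∑ i ∈ s, f i) η (s.card * ε) (s.card * L) := by
  classical
  induction s using Finset.induction_on with
  | empty => simpa using OscBound.zero
  | insert i s hi ih =>
    rw [Finset.sum_insert hi, Finset.card_insert_of_notMem hi]
    have := (hf i (Finset.mem_insert_self i s)).add
      (ih fun j hj => hf j (Finset.mem_insert_of_mem hj))
    convert this using 1 <;> · push_cast; ring

theorem gramOp_starSec (e : Trivialization F (π F E)) [e.IsLinear ℂ] (f : ∀ x, E x →L[ℂ] E x)
    (x : Base G Y) (u v : F) :
    inner ℂ v (gramOp e (starSec f) x u) = starRingEnd ℂ (inner ℂ u (gramOp e f x v)) := by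
  rw [inner_gramOp, inner_gramOp, starSec, ContinuousLinearMap.adjoint_inner_right, inner_conj_symm]

theorem OscBound.starSec {η ε L : ℝ} (hf : OscBound 𝒞 h f η ε L) :
    OscBound 𝒞 h (starSec f) η ε L := by
  intro c hc x y hx hxy u v
  rw [gramOp_starSec, gramOp_starSec, ← map_sub, RCLike.norm_conj, add_comm (quad h _)]
  exact hf c hc x y hx hxy v u

theorem OscBound.of_tendsto {ι : Type*} {l : Filter ι} [l.NeBot] {φ : ι → ∀ x, E x →L[ℂ] E x}
    {η ε L : ℝ} (hφ : ∀ᶠ i in l, OscBound 𝒞 h (φ i) η ε L)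
    (hlim : ∀ x, Tendsto (fun i => φ i x) l (𝓝 (f x))) : OscBound 𝒞 h f η ε L := by
  intro c hc x y hx hxy u v
  have h1 : ∀ x, Tendsto (fun i => inner ℂ v (gramOp (𝒞.triv c) (φ i) x u)) l
      (𝓝 (inner ℂ v (gramOp (𝒞.triv c) f x u))) := fun x => by
    simp only [inner_gramOp]
    exact Tendsto.inner tendsto_const_nhds
      (((ContinuousLinearMap.apply ℂ (E x) _).continuous.tendsto _).comp (hlim x))
  exact le_of_tendsto ((h1 _).sub (h1 _)).norm (hφ.mono fun i hi => hi c hc x y hx hxy u v)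

/-- A section whose forms oscillate little is controlled by its values on a fine enough net. -/
theorem OscBound.formBound_of_net [IsIsometricSMul G Y] {C η ε L ρ κ : ℝ} (hC0 : 0 < C)
    (hC : Comparable 𝒞 h C) (hL : 0 ≤ L) (hf : OscBound 𝒞 h f η ε L) (hρ : ρ ≤ η)
    (hρ' : ∀ c ∈ 𝒞.centers, ρ ≤ 𝒞.rad c) (hκ : 0 ≤ κ) {s : Set Y}
    (hs : ∀ x : Base G Y, ∃ c ∈ s, ∃ y ∈ Metric.ball c ρ, proj G y = x)
    (hfs : ∀ c ∈ s, ∀ u v : E (proj G c), ‖inner ℂ v (f _ u)‖ ≤ κ * ((quad h u + quad h v) / 2)) :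
    FormBound h f (κ * C ^ 2 + ε + L * ρ) := by
  intro x u v
  obtain ⟨z, hz, y, hy, rfl⟩ := hs x
  rw [Metric.mem_ball] at hy
  obtain ⟨c, hc, hx⟩ := 𝒞.exists_mem_small (proj G y)
  have hx' := 𝒞.small_subset_large c hx
  have hz' := 𝒞.mem_large_of_dist_lt hx (hy.trans_le (hρ' c hc))
  obtain ⟨u, rfl⟩ := exists_symmL_eq 𝒞 hx' u
  obtain ⟨v, rfl⟩ := exists_symmL_eq 𝒞 hx' v
  have h1 := hf c hc y z hx (hy.trans_le hρ) u v
  have h2 := hfs z hz ((𝒞.triv c).symmL ℂ _ u) ((𝒞.triv c).symmL ℂ _ v)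
  rw [← inner_gramOp] at h2 ⊢
  have hq : ∀ w : F, quad h ((𝒞.triv c).symmL ℂ (proj G z) w) ≤
      C ^ 2 * quad h ((𝒞.triv c).symmL ℂ (proj G y) w) := fun w => by
    have h3 := (hC c hc _ hz' w).2
    have h4 := (hC c hc _ hx' w).1
    nlinarith
  have h3 := quad_frame_nonneg hC0 hC hc hx' u
  have h4 := quad_frame_nonneg hC0 hC hc hx' v
  set a := inner ℂ v (gramOp (𝒞.triv c) f (proj G y) u)
  set b := inner ℂ v (gramOp (𝒞.triv c) f (proj G z) u)
  calc ‖a‖ = ‖b - (b - a)‖ := by rw [sub_sub_cancel]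
    _ ≤ ‖b‖ + ‖b - a‖ := norm_sub_le _ _
    _ ≤ κ * ((C ^ 2 * quad h ((𝒞.triv c).symmL ℂ (proj G y) u) +
          C ^ 2 * quad h ((𝒞.triv c).symmL ℂ (proj G y) v)) / 2) +
        (ε + L * ρ) * ((quad h ((𝒞.triv c).symmL ℂ (proj G y) u) +
          quad h ((𝒞.triv c).symmL ℂ (proj G y) v)) / 2) := by
        refine add_le_add (h2.trans ?_) (h1.trans ?_)
        · have := hq u; have := hq v; gcongr
        · gcongr
    _ = _ := by ring

end Oscillation

/-! ### The Lasota–Yorke inequality -/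

section LasotaYorke

variable {G Y : Type*} [Group G] [MulAction G Y] [MetricSpace Y] {D : Dilation G Y}
  {F : Type*} [NormedAddCommGroup F] [InnerProductSpace ℂ F] [CompleteSpace F]
  [FiniteDimensional ℂ F]
  {E : Base G Y → Type*} [∀ x, NormedAddCommGroup (E x)] [∀ x, InnerProductSpace ℂ (E x)]
  [∀ x, CompleteSpace (E x)] [TopologicalSpace (TotalSpace F E)] [FiberBundle F E]
  [VectorBundle ℂ F E] {𝒜 : LipschitzAtlas F E}
  {m : ∀ x, E (D.baseMap x) →L[ℂ] E x}

variable (D m) in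
/-- The matrix of `m`, over the point `p z`, in two local trivializations. -/
def localMat (e e' : Trivialization F (π F E)) [e.IsLinear ℂ] [e'.IsLinear ℂ] (z : Y) :
    F →L[ℂ] F :=
  (e.continuousLinearMapAt ℂ (proj G z)).comp
    ((m (proj G z)).comp (e'.symmL ℂ (D.baseMap (proj G z))))

theorem castFib_symmL (e : Trivialization F (π F E)) [e.IsLinear ℂ] {x x' : Base G Y}
    (hx : x = x') (u : F) : castFib hx (e.symmL ℂ x u) = e.symmL ℂ x' u := by
  subst hx; rfl

theorem stepMap_symmL (e e' : Trivialization F (π F E)) [e.IsLinear ℂ] [e'.IsLinear ℂ]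
    (i : Fin D.q) (y : Y) (hy : proj G (D.branch i y) ∈ e.baseSet) (u : F) :
    stepMap D m i y (e'.symmL ℂ (proj G y) u) =
      e.symmL ℂ (proj G (D.branch i y)) (localMat D m e e' (D.branch i y) u) := by
  rw [stepMap, ContinuousLinearMap.comp_apply, castFib_symmL, localMat,
    ContinuousLinearMap.comp_apply, e.symmL_continuousLinearMapAt hy]
  rfl

theorem dist_branch_le [IsIsometricSMul G Y] (i : Fin D.q) (x y : Y) :
    dist (D.branch i x) (D.branch i y) ≤ D.θ * dist x y := by
  have h1 := D.expansive (D.branch i x) (D.branch i y)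
  rw [Dilation.branch, Dilation.branch, Homeomorph.apply_symm_apply, Homeomorph.apply_symm_apply,
    dist_smul, mul_comm] at h1
  exact h1

theorem exists_lipschitz_localMat (𝒞 : FiniteCover 𝒜) (hm : 𝒜.IsLipschitzMap D m) :
    ∃ K > 0, ∀ c ∈ 𝒞.centers, ∀ c' ∈ 𝒞.centers, ∀ z w : Y,
      proj G z ∈ (𝒞.triv c).baseSet → D.baseMap (proj G z) ∈ (𝒞.triv c').baseSet →
      proj G w ∈ (𝒞.triv c).baseSet → D.baseMap (proj G w) ∈ (𝒞.triv c').baseSet →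
      ‖localMat D m (𝒞.triv c) (𝒞.triv c') z - localMat D m (𝒞.triv c) (𝒞.triv c') w‖ ≤
        K * dist z w := by
  have h1 : ∀ᶠ K : ℝ in atTop, ∀ c ∈ 𝒞.centers, ∀ c' ∈ 𝒞.centers, ∀ z w : Y,
      proj G z ∈ (𝒞.triv c).baseSet → D.baseMap (proj G z) ∈ (𝒞.triv c').baseSet →
      proj G w ∈ (𝒞.triv c).baseSet → D.baseMap (proj G w) ∈ (𝒞.triv c').baseSet →
      ‖localMat D m (𝒞.triv c) (𝒞.triv c') z - localMat D m (𝒞.triv c) (𝒞.triv c') w‖ ≤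
        K * dist z w := by
    refine (eventually_all_finset 𝒞.centers).2 fun c _ =>
      (eventually_all_finset 𝒞.centers).2 fun c' _ => ?_
    obtain ⟨K, hK⟩ := hm (𝒞.chart c) (𝒞.chart c')
    filter_upwards [eventually_ge_atTop (K : ℝ)] with K' hK' z w hz hz' hw hw'
    have h2 := hK.dist_le_mul z ⟨hz, hz'⟩ w ⟨hw, hw'⟩
    rw [dist_eq_norm] at h2
    exact h2.trans (by gcongr)
  obtain ⟨K, h2, h3⟩ := (h1.and (eventually_gt_atTop 0)).exists
  exact ⟨K, h3, h2⟩

variable {𝒞 : FiniteCover 𝒜} {h f g : ∀ x, E x →L[ℂ] E x}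

/-- As `∑ m* h m = h`, a single summand is bounded by `h`; this bounds the matrices of `m`. -/
theorem norm_localMat_le {C : ℝ} (hC0 : 0 < C) (hC : Comparable 𝒞 h C)
    (hpos : ∀ x, (h x).IsPositive) (hh : transfer D m h = h) {c c' : Y} (hc : c ∈ 𝒞.centers)
    (hc' : c' ∈ 𝒞.centers) (i : Fin D.q) (y : Y) (hy : proj G y ∈ 𝒞.large c')
    (hz : proj G (D.branch i y) ∈ 𝒞.large c) :
    ‖localMat D m (𝒞.triv c) (𝒞.triv c') (D.branch i y)‖ ≤ C := by
  refine ContinuousLinearMap.opNorm_le_bound _ hC0.le fun u => ?_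
  have h1 := (hC c hc _ hz (localMat D m (𝒞.triv c) (𝒞.triv c') (D.branch i y) u)).1
  rw [← stepMap_symmL _ _ i y (𝒞.large_subset c hz)] at h1
  have h2 : quad h (stepMap D m i y ((𝒞.triv c').symmL ℂ (proj G y) u)) ≤
      quad h ((𝒞.triv c').symmL ℂ (proj G y) u) := by
    rw [← sum_quad_stepMap hh y]
    exact Finset.single_le_sum
      (f := fun i => quad h (stepMap D m i y ((𝒞.triv c').symmL ℂ (proj G y) u)))
      (fun j _ => quad_nonneg hpos _) (Finset.mem_univ i)
  have h3 := (hC c' hc' _ hy u).2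
  refine le_of_sq_le_sq ?_ (by positivity)
  nlinarith

theorem inner_gramOp_transfer (c : Y) (κ : Fin D.q → Y) (y : Y)
    (hκ : ∀ i, proj G (D.branch i y) ∈ (𝒞.triv (κ i)).baseSet) (u v : F) :
    inner ℂ v (gramOp (𝒞.triv c) (transfer D m f) (proj G y) u) =
      ∑ i, inner ℂ (localMat D m (𝒞.triv (κ i)) (𝒞.triv c) (D.branch i y) v)
        (gramOp (𝒞.triv (κ i)) f (proj G (D.branch i y))
          (localMat D m (𝒞.triv (κ i)) (𝒞.triv c) (D.branch i y) u)) := by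
  rw [inner_gramOp, inner_transfer_proj]
  refine Finset.sum_congr rfl fun i _ => ?_
  rw [inner_gramOp, stepMap_symmL _ _ i y (hκ i), stepMap_symmL _ _ i y (hκ i)]

/-- The Lasota–Yorke inequality: one application of the transfer operator contracts the Lipschitz
part of the modulus of continuity by `θ`, up to a multiple of the norm. Measuring with `h` makes the
contraction constant of the first term exactly `θ`, because `∑ m* h m = h`. -/
theorem exists_oscBound_transfer [IsIsometricSMul G Y] (𝒞 : FiniteCover 𝒜) {C : ℝ} (hC0 : 0 < C)
    (hC : Comparable 𝒞 h C) (hpos : ∀ x, (h x).IsPositive) (hh : transfer D m h = h)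
    (hm : 𝒜.IsLipschitzMap D m) :
    ∃ K > 0, ∀ (f : ∀ x, E x →L[ℂ] E x) (N η ε L : ℝ), 0 ≤ N → 0 ≤ L → 0 < η →
      (∀ c ∈ 𝒞.centers, η ≤ 𝒞.rad c) → FormBound h f N → OscBound 𝒞 h f (D.θ * η) ε L →
      OscBound 𝒞 h (transfer D m f) η ε (D.θ * L + K * N) := by
  obtain ⟨K, hK, hLip⟩ := exists_lipschitz_localMat (m := m) 𝒞 hm
  refine ⟨(D.q + 1) * (2 * C ^ 3 * K), by positivity, ?_⟩
  intro f N η ε L hN hL hη hηrad hfN hf c hc x y hx hxy u v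
  have hx' := 𝒞.small_subset_large c hx
  have hy' := 𝒞.mem_large_of_dist_lt hx (hxy.trans_le (hηrad c hc))
  choose κ hκ hκs using fun i => 𝒞.exists_mem_small (proj G (D.branch i x))
  have hθ := D.θ_lt_one
  have hd : ∀ i, dist (D.branch i x) (D.branch i y) < D.θ * η := fun i =>
    (dist_branch_le i x y).trans_lt (mul_lt_mul_of_pos_left hxy D.θ_pos)
  have hzl : ∀ i, proj G (D.branch i x) ∈ 𝒞.large (κ i) := fun i =>
    𝒞.small_subset_large _ (hκs i)
  have hwl : ∀ i, proj G (D.branch i y) ∈ 𝒞.large (κ i) := fun i =>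
    𝒞.mem_large_of_dist_lt (hκs i) ((hd i).trans_le
      ((mul_le_of_le_one_left hη.le hθ.le).trans (hηrad _ (hκ i))))
  rw [inner_gramOp_transfer c κ x fun i => 𝒞.large_subset _ (hzl i),
    inner_gramOp_transfer c κ y fun i => 𝒞.large_subset _ (hwl i), ← Finset.sum_sub_distrib]
  set A := fun i => localMat D m (𝒞.triv (κ i)) (𝒞.triv c) (D.branch i x) with hA
  set B := fun i => localMat D m (𝒞.triv (κ i)) (𝒞.triv c) (D.branch i y) with hB
  set S := fun i => gramOp (𝒞.triv (κ i)) f (proj G (D.branch i x)) with hS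
  set T := fun i => gramOp (𝒞.triv (κ i)) f (proj G (D.branch i y)) with hT
  have hAn : ∀ i, ‖A i‖ ≤ C := fun i =>
    norm_localMat_le hC0 hC hpos hh (hκ i) hc i x hx' (hzl i)
  have hBn : ∀ i, ‖B i‖ ≤ C := fun i =>
    norm_localMat_le hC0 hC hpos hh (hκ i) hc i y hy' (hwl i)
  have hBA : ∀ i, ‖B i - A i‖ ≤ K * dist x y := fun i => by
    have h1 := hLip (κ i) (hκ i) c hc (D.branch i y) (D.branch i x)
      (𝒞.large_subset _ (hwl i)) (by rw [D.baseMap_branch]; exact 𝒞.large_subset _ hy')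
      (𝒞.large_subset _ (hzl i)) (by rw [D.baseMap_branch]; exact 𝒞.large_subset _ hx')
    refine h1.trans (mul_le_mul_of_nonneg_left ?_ hK.le)
    rw [dist_comm]
    exact (dist_branch_le i x y).trans (mul_le_of_le_one_left dist_nonneg hθ.le)
  have hTn : ∀ i, ‖T i‖ ≤ N * C := fun i => hfN.norm_gramOp_le hN hC0.le hC (hκ i) (hwl i)
  set qu := quad h ((𝒞.triv c).symmL ℂ (proj G x) u)
  set qv := quad h ((𝒞.triv c).symmL ℂ (proj G x) v)
  have hqu : ‖u‖ ^ 2 ≤ C * qu := (hC c hc _ hx' u).1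
  have hqv : ‖v‖ ^ 2 ≤ C * qv := (hC c hc _ hx' v).1
  set t := dist x y with ht
  have ht0 : 0 ≤ t := dist_nonneg
  -- the change of `f` is contracted; the change of `m` costs a multiple of `N`
  have hterm : ∀ i, ‖inner ℂ (B i v) (T i (B i u)) - inner ℂ (A i v) (S i (A i u))‖ ≤
      (ε + D.θ * L * t) * ((quad h (stepMap D m i x ((𝒞.triv c).symmL ℂ (proj G x) u)) +
        quad h (stepMap D m i x ((𝒞.triv c).symmL ℂ (proj G x) v))) / 2) +
      2 * C ^ 3 * K * N * t * ((qu + qv) / 2) := by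
    intro i
    have h1 := hf (κ i) (hκ i) (D.branch i x) (D.branch i y) (hκs i) (hd i) (A i u) (A i v)
    rw [← stepMap_symmL _ _ i x (𝒞.large_subset _ (hzl i)),
      ← stepMap_symmL _ _ i x (𝒞.large_subset _ (hzl i))] at h1
    have h2 : inner ℂ (B i v) (T i (B i u)) - inner ℂ (A i v) (S i (A i u)) =
        (inner ℂ (A i v) (T i (A i u)) - inner ℂ (A i v) (S i (A i u))) +
        (inner ℂ (B i v) (T i ((B i - A i) u)) + inner ℂ ((B i - A i) v) (T i (A i u))) := by
      simp only [sub_apply, map_sub, inner_sub_right, inner_sub_left]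
      ring
    have hbil : ∀ (P Q : F →L[ℂ] F) (a b : ℝ), 0 ≤ a → 0 ≤ b → ‖P‖ ≤ a → ‖Q‖ ≤ b →
        ‖inner ℂ (P v) (T i (Q u))‖ ≤ N * C * (a * b) * (‖u‖ * ‖v‖) := by
      intro P Q a b ha hb hP hQ
      calc ‖inner ℂ (P v) (T i (Q u))‖ ≤ ‖P v‖ * ‖T i (Q u)‖ := norm_inner_le_norm _ _
        _ ≤ (a * ‖v‖) * (N * C * (b * ‖u‖)) := by
            gcongr
            · exact P.le_of_opNorm_le hP v
            · exact (ContinuousLinearMap.le_of_opNorm_le _ (hTn i) _).trans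
                (by gcongr; exact Q.le_of_opNorm_le hQ u)
        _ = _ := by ring
    have h3 := hbil (B i) (B i - A i) C (K * t) hC0.le (by positivity) (hBn i) (hBA i)
    have h4 := hbil (B i - A i) (A i) (K * t) C (by positivity) hC0.le (hBA i) (hAn i)
    have h5 : ‖u‖ * ‖v‖ ≤ C * ((qu + qv) / 2) := by nlinarith [sq_nonneg (‖u‖ - ‖v‖)]
    have hq : ∀ w : F, 0 ≤ quad h (stepMap D m i x ((𝒞.triv c).symmL ℂ (proj G x) w)) :=
      fun w => quad_nonneg hpos _
    rw [h2]
    refine (norm_add_le _ _).trans (add_le_add (h1.trans ?_) ((norm_add_le _ _).trans ?_))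
    · refine mul_le_mul_of_nonneg_right ?_ (by linarith [hq u, hq v])
      have := mul_le_mul_of_nonneg_left (dist_branch_le i x y) hL
      linarith
    · calc _ ≤ N * C * (C * (K * t)) * (‖u‖ * ‖v‖) + N * C * (K * t * C) * (‖u‖ * ‖v‖) :=
            add_le_add h3 h4
        _ = 2 * (N * C ^ 2 * K * t) * (‖u‖ * ‖v‖) := by ring
        _ ≤ 2 * (N * C ^ 2 * K * t) * (C * ((qu + qv) / 2)) := by gcongr
        _ = _ := by ring
  have hqq : 0 ≤ (qu + qv) / 2 := by
    have := quad_nonneg hpos ((𝒞.triv c).symmL ℂ (proj G x) u)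
    have := quad_nonneg hpos ((𝒞.triv c).symmL ℂ (proj G x) v)
    positivity
  refine (norm_sum_le _ _).trans ((Finset.sum_le_sum fun i _ => hterm i).trans ?_)
  rw [Finset.sum_add_distrib, ← Finset.mul_sum, ← Finset.sum_div, Finset.sum_add_distrib,
    sum_quad_stepMap hh, sum_quad_stepMap hh, Finset.sum_const, Finset.card_univ, Fintype.card_fin,
    nsmul_eq_mul]
  have h6 : 0 ≤ 2 * C ^ 3 * K * N * t * ((qu + qv) / 2) := by positivity
  change (ε + D.θ * L * t) * ((qu + qv) / 2) + _ ≤ _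
  linarith

end LasotaYorke

/-! ### Orbits and fixed points of the transfer operator -/

section Definite

variable {X : Type*} {E : X → Type*} [∀ x, NormedAddCommGroup (E x)]
  [∀ x, InnerProductSpace ℂ (E x)] {h f : ∀ x, E x →L[ℂ] E x}

theorem quad_one {x : X} (u : E x) : quad (fun x => (1 : E x →L[ℂ] E x)) u = ‖u‖ ^ 2 := by
  change (inner ℂ u u).re = _
  rw [inner_self_eq_norm_sq_to_K]
  norm_cast

theorem FormBound.norm_le {N : ℝ} (hN : 0 ≤ N)
    (hf : FormBound (fun x => (1 : E x →L[ℂ] E x)) f N) (x : X) : ‖f x‖ ≤ N :=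
  opNorm_le_of_norm_inner_le hN fun u v => by
    have := hf x u v
    rwa [quad_one, quad_one] at this

theorem quad_le_norm (x : X) (u : E x) : quad h u ≤ ‖h x‖ * ‖u‖ ^ 2 :=
  calc quad h u ≤ ‖u‖ * ‖h x u‖ := (Complex.re_le_norm _).trans (norm_inner_le_norm _ _)
    _ ≤ ‖u‖ * (‖h x‖ * ‖u‖) := by gcongr; exact (h x).le_opNorm u
    _ = _ := by ring

theorem FormBound.norm_le_mul {N : ℝ} (hN : 0 ≤ N) (hf : FormBound h f N) (x : X) :
    ‖f x‖ ≤ N * ‖h x‖ := by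
  refine opNorm_le_of_norm_inner_le (by positivity) fun u v => (hf x u v).trans ?_
  have h1 := quad_le_norm (h := h) x u
  have h2 := quad_le_norm (h := h) x v
  calc N * ((quad h u + quad h v) / 2) ≤ N * ((‖h x‖ * ‖u‖ ^ 2 + ‖h x‖ * ‖v‖ ^ 2) / 2) := by gcongr
    _ = _ := by ring

variable [∀ x, CompleteSpace (E x)]

theorem quad_pos (hpos : ∀ x, (h x).IsPositive) (hunit : ∀ x, IsUnit (h x)) (x : X) (u : E x)
    (hu : u ≠ 0) : 0 < quad h u := by
  have h0 : (0 : E x →L[ℂ] E x) ≤ h x := (ContinuousLinearMap.nonneg_iff_isPositive _).2 (hpos x)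
  set k := CFC.sqrt (h x) with hk
  have hkk : k * k = h x := CFC.sqrt_mul_sqrt_self (h x) h0
  have hks : IsSelfAdjoint k := IsSelfAdjoint.of_nonneg (CFC.sqrt_nonneg (h x))
  have h1 : quad h u = ‖k u‖ ^ 2 := by
    rw [quad, ← hkk, mul_apply_eq_comp,
      ← ContinuousLinearMap.adjoint_inner_left, hks.adjoint_eq, inner_self_eq_norm_sq_to_K]
    norm_cast
  rw [h1]
  have hinj : Function.Injective (h x) := (ContinuousLinearMap.isUnit_iff_bijective.1 (hunit x)).1
  have h2 : k u ≠ 0 := fun h3 => hu <| hinj <| by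
    rw [map_zero, ← hkk, mul_apply_eq_comp, h3, map_zero]
  positivity

end Definite

theorem finiteDimensional_fiber {X : Type*} [TopologicalSpace X] (F : Type*)
    [NormedAddCommGroup F] [NormedSpace ℂ F] [FiniteDimensional ℂ F] {E : X → Type*}
    [∀ x, NormedAddCommGroup (E x)] [∀ x, NormedSpace ℂ (E x)] [TopologicalSpace (TotalSpace F E)]
    [FiberBundle F E] [VectorBundle ℂ F E] (x : X) : FiniteDimensional ℂ (E x) :=
  LinearEquiv.finiteDimensional ((trivializationAt F E x).continuousLinearEquivAt ℂ x
    (mem_baseSet_trivializationAt F E x)).symm.toLinearEquiv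

section Ergodic

variable {G Y : Type*} [Group G] [MulAction G Y] [MetricSpace Y] {D : Dilation G Y}
  {F : Type*} [NormedAddCommGroup F] [InnerProductSpace ℂ F] [CompleteSpace F]
  [FiniteDimensional ℂ F]
  {E : Base G Y → Type*} [∀ x, NormedAddCommGroup (E x)] [∀ x, InnerProductSpace ℂ (E x)]
  [∀ x, CompleteSpace (E x)] [TopologicalSpace (TotalSpace F E)] [FiberBundle F E]
  [VectorBundle ℂ F E] {𝒜 : LipschitzAtlas F E}
  {m : ∀ x, E (D.baseMap x) →L[ℂ] E x} {h f g : ∀ x, E x →L[ℂ] E x}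

/-- The standing assumptions on the bundle, on `m` and on the harmonic section `h`. -/
structure HarmonicSetup (D : Dilation G Y) (𝒜 : LipschitzAtlas F E)
    (m : ∀ x, E (D.baseMap x) →L[ℂ] E x) (h : ∀ x, E x →L[ℂ] E x) : Prop where
  metric : IsHermitianMetric F E
  lipschitz : 𝒜.IsLipschitzMap D m
  isEnd : IsBundleEnd F E h
  harmonic : transfer D m h = h
  pos : ∀ x, (h x).IsPositive
  isUnit : ∀ x, IsUnit (h x)

namespace HarmonicSetup

theorem exists_comparable (H : HarmonicSetup D 𝒜 m h) (𝒞 : FiniteCover 𝒜) :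
    ∃ C > 0, Comparable 𝒞 h C :=
  MatrixTransfer.exists_comparable 𝒞 H.metric H.isEnd (quad_pos H.pos H.isUnit)

variable [IsIsometricSMul G Y]

/-- Along the orbit of `f` under the transfer operator the moduli of continuity stay bounded, by the
Lasota–Yorke inequality. -/
theorem exists_oscBound_iterate (H : HarmonicSetup D 𝒜 m h) {𝒞 : FiniteCover 𝒜} {C : ℝ}
    (hC0 : 0 < C) (hC : Comparable 𝒞 h C) (hf : IsBundleEnd F E f) {N : ℝ} (hN : 0 ≤ N)
    (hfN : FormBound h f N) :
    ∃ L ≥ 0, ∀ ε > 0, ∃ η > 0, ∀ j, OscBound 𝒞 h ((transfer D m)^[j] f) η ε L := by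
  obtain ⟨K, hK, hLY⟩ := exists_oscBound_transfer 𝒞 hC0 hC H.pos H.harmonic H.lipschitz
  have hθ := D.θ_lt_one
  have hθ' : 0 < 1 - D.θ := by linarith
  refine ⟨K * N / (1 - D.θ), by positivity, fun ε hε => ?_⟩
  obtain ⟨η, hη, h1⟩ := hf.exists_oscBound H.metric hC0 hC hε
  obtain ⟨δ, hδ, h2⟩ := 𝒞.exists_le_rad
  refine ⟨min η δ, lt_min hη hδ, fun j => ?_⟩
  induction j with
  | zero => exact h1.mono hC0 hC (min_le_left _ _) le_rfl (by positivity)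
  | succ j ih =>
    rw [Function.iterate_succ_apply']
    have h3 := hLY _ N (min η δ) ε _ hN (by positivity) (lt_min hη hδ)
      (fun c hc => (min_le_right _ _).trans (h2 c hc)) (hfN.transfer_iterate H.harmonic j)
      (ih.mono hC0 hC (mul_le_of_le_one_left (lt_min hη hδ).le hθ.le) le_rfl le_rfl)
    refine h3.mono hC0 hC le_rfl le_rfl (le_of_eq ?_)
    field_simp
    ring

/-- Harmonic sections are Lipschitz at a uniform scale, with a constant controlled by their norm. -/
theorem exists_oscBound_of_harmonic (H : HarmonicSetup D 𝒜 m h) {𝒞 : FiniteCover 𝒜} {C : ℝ}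
    (hC0 : 0 < C) (hC : Comparable 𝒞 h C) :
    ∃ K > 0, ∃ δ > 0, (∀ c ∈ 𝒞.centers, δ ≤ 𝒞.rad c) ∧ ∀ (f : ∀ x, E x →L[ℂ] E x) (N : ℝ),
      IsBundleEnd F E f → transfer D m f = f → 0 ≤ N → FormBound h f N →
      OscBound 𝒞 h f δ 0 (K * N) := by
  obtain ⟨K, hK, hLY⟩ := exists_oscBound_transfer 𝒞 hC0 hC H.pos H.harmonic H.lipschitz
  obtain ⟨δ, hδ, h2⟩ := 𝒞.exists_le_rad
  have hθ := D.θ_lt_one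
  have hθ0 := D.θ_pos
  have hθ' : 0 < 1 - D.θ := by linarith
  refine ⟨K / (1 - D.θ), by positivity, δ, hδ, h2, fun f N hf hRf hN hfN => ?_⟩
  have hL : 0 ≤ K / (1 - D.θ) * N := by positivity
  have h3 : ∀ ε > 0, OscBound 𝒞 h f δ ε (K / (1 - D.θ) * N) := by
    intro ε hε
    obtain ⟨η, hη, h1⟩ := hf.exists_oscBound H.metric hC0 hC hε
    have h4 : ∀ n : ℕ, OscBound 𝒞 h f (D.θ ^ n * δ) ε (K / (1 - D.θ) * N) →
        OscBound 𝒞 h f δ ε (K / (1 - D.θ) * N) := by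
      intro n
      induction n with
      | zero => intro h5; simpa using h5
      | succ n ih =>
        intro h5
        refine ih ?_
        have h6 := hLY f N (D.θ ^ n * δ) ε _ hN hL (by positivity)
          (fun c hc => (mul_le_of_le_one_left hδ.le (pow_le_one₀ hθ0.le hθ.le)).trans (h2 c hc))
          hfN (by rwa [← mul_assoc, ← pow_succ'])
        rw [hRf] at h6
        refine h6.mono hC0 hC le_rfl le_rfl (le_of_eq ?_)
        field_simp
        ring
    obtain ⟨n, hn⟩ := exists_pow_lt_of_lt_one (div_pos hη hδ) hθ
    exact h4 n (h1.mono hC0 hC ((lt_div_iff₀ hδ).1 hn).le le_rfl hL)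
  intro c hc x y hx hxy u v
  set M := (quad h ((𝒞.triv c).symmL ℂ (proj G x) u) +
    quad h ((𝒞.triv c).symmL ℂ (proj G x) v)) / 2
  have h5 : Tendsto (fun ε : ℝ => (ε + K / (1 - D.θ) * N * dist x y) * M) (𝓝[>] 0)
      (𝓝 ((0 + K / (1 - D.θ) * N * dist x y) * M)) :=
    (Continuous.tendsto (by fun_prop) 0).mono_left nhdsWithin_le_nhds
  exact ge_of_tendsto h5
    (by filter_upwards [self_mem_nhdsWithin] with ε hε using h3 ε hε c hc x y hx hxy u v)

variable [CompactSpace (Base G Y)] [LocallyCompactSpace Y]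

theorem exists_formBound (H : HarmonicSetup D 𝒜 m h) (hf : IsBundleEnd F E f) :
    ∃ N ≥ 0, FormBound h f N := by
  obtain ⟨𝒞⟩ := exists_finiteCover 𝒜
  obtain ⟨C, hC0, hC⟩ := H.exists_comparable 𝒞
  exact hf.exists_formBound H.metric hC0 hC

theorem exists_norm_le (H : HarmonicSetup D 𝒜 m h) (hf : IsBundleEnd F E f) :
    ∃ N ≥ 0, ∀ x, ‖f x‖ ≤ N := by
  obtain ⟨𝒞⟩ := exists_finiteCover 𝒜
  obtain ⟨C, hC0, hC⟩ := MatrixTransfer.exists_comparable 𝒞 H.metric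
    (h := fun x => (1 : E x →L[ℂ] E x)) continuous_id
    (fun x u hu => by rw [quad_one]; positivity)
  obtain ⟨N, hN, h1⟩ := hf.exists_formBound H.metric hC0 hC
  exact ⟨N, hN, h1.norm_le hN⟩

/-- A harmonic section is determined by its values at finitely many points. -/
theorem exists_finset_eq_zero (H : HarmonicSetup D 𝒜 m h) :
    ∃ s : Finset Y, ∀ f : ∀ x, E x →L[ℂ] E x, IsBundleEnd F E f → transfer D m f = f →
      (∀ c ∈ s, f (proj G c) = 0) → f = 0 := by
  obtain ⟨𝒞⟩ := exists_finiteCover 𝒜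
  obtain ⟨C, hC0, hC⟩ := H.exists_comparable 𝒞
  obtain ⟨K, hK, δ, hδ, hδr, hosc⟩ := H.exists_oscBound_of_harmonic hC0 hC
  set ρ := min δ (1 / (2 * K)) with hρdef
  have hρ : 0 < ρ := lt_min hδ (by positivity)
  obtain ⟨s, hs⟩ := exists_finite_centers (G := G) (fun _ : Y => ρ) (fun _ => hρ)
  refine ⟨s, fun f hf hRf hfs => ?_⟩
  -- vanishing on the net halves every bound
  have hhalf : ∀ N, 0 ≤ N → FormBound h f N → FormBound h f (N / 2) := by
    intro N hN hfN
    have h1 := (hosc f N hf hRf hN hfN).formBound_of_net hC0 hC (by positivity) (min_le_left _ _)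
      (fun c hc => (min_le_left _ _).trans (hδr c hc)) le_rfl (s := s) hs
      (fun c hc u v => by rw [hfs c hc]; simp)
    refine h1.mono H.pos ?_
    have h2 : K * N * ρ ≤ K * N * (1 / (2 * K)) := by gcongr; exact min_le_right _ _
    have h3 : K * N * (1 / (2 * K)) = N / 2 := by field_simp
    linarith
  obtain ⟨N, hN, hfN⟩ := H.exists_formBound hf
  have hpow : ∀ n : ℕ, FormBound h f (N * (1 / 2) ^ n) := by
    intro n
    induction n with
    | zero => simpa using hfN
    | succ n ih =>
      have := hhalf _ (by positivity) ih
      rwa [pow_succ, ← mul_assoc, mul_one_div]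
  refine FormBound.eq_zero_of_forall (h := h) fun ε hε => ?_
  have h4 : Tendsto (fun n : ℕ => N * (1 / 2 : ℝ) ^ n) atTop (𝓝 (N * 0)) :=
    (tendsto_pow_atTop_nhds_zero_of_lt_one (by norm_num) (by norm_num)).const_mul N
  rw [mul_zero] at h4
  obtain ⟨n, hn⟩ := (h4.eventually_lt_const hε).exists
  exact (hpow n).mono H.pos hn.le

end HarmonicSetup

end Ergodic

/-! ### The mean ergodic theorem -/

section Ergodic

variable {G Y : Type*} [Group G] [MulAction G Y] [MetricSpace Y] {D : Dilation G Y}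
  {F : Type*} [NormedAddCommGroup F] [InnerProductSpace ℂ F] [CompleteSpace F]
  [FiniteDimensional ℂ F]
  {E : Base G Y → Type*} [∀ x, NormedAddCommGroup (E x)] [∀ x, InnerProductSpace ℂ (E x)]
  [∀ x, CompleteSpace (E x)] [TopologicalSpace (TotalSpace F E)] [FiberBundle F E]
  [VectorBundle ℂ F E] {𝒜 : LipschitzAtlas F E}
  {m : ∀ x, E (D.baseMap x) →L[ℂ] E x} {h f g : ∀ x, E x →L[ℂ] E x}

section Algebra

theorem cesaro_eq (g : ∀ x, E x →L[ℂ] E x) (k : ℕ) :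
    cesaro D m g k = (k : ℂ)⁻¹ • ∑ j ∈ Finset.range k, (transfer D m)^[j + 1] g := by
  funext x
  rw [cesaro, Pi.smul_apply, Finset.sum_apply, Finset.range_eq_Ico,
    Finset.sum_Ico_add' (fun j => (transfer D m)^[j] g x) 0 k 1]
  rfl

theorem cesaro_eq_transferL (g : ∀ x, E x →L[ℂ] E x) (k : ℕ) :
    cesaro D m g k =
      ((k : ℂ)⁻¹ • (transferL D m * ∑ j ∈ Finset.range k, transferL D m ^ j)) g := by
  rw [cesaro_eq, LinearMap.smul_apply, Finset.mul_sum, LinearMap.sum_apply]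
  simp only [← pow_succ', transferL_pow_apply]

theorem cesaro_add (f g : ∀ x, E x →L[ℂ] E x) (k : ℕ) :
    cesaro D m (f + g) k = cesaro D m f k + cesaro D m g k := by
  simp only [cesaro_eq_transferL, map_add]

theorem cesaro_sub (f g : ∀ x, E x →L[ℂ] E x) (k : ℕ) :
    cesaro D m (f - g) k = cesaro D m f k - cesaro D m g k := by
  simp only [cesaro_eq_transferL, map_sub]

theorem cesaro_smul (r : ℂ) (g : ∀ x, E x →L[ℂ] E x) (k : ℕ) :
    cesaro D m (r • g) k = r • cesaro D m g k := by
  simp only [cesaro_eq_transferL, map_smul]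

theorem iterate_eq_of_fixed (hf : transfer D m f = f) (j : ℕ) : (transfer D m)^[j] f = f :=
  Function.iterate_fixed hf j

theorem cesaro_of_fixed (hf : transfer D m f = f) {k : ℕ} (hk : k ≠ 0) : cesaro D m f k = f := by
  rw [cesaro_eq]
  simp only [iterate_eq_of_fixed hf, Finset.sum_const, Finset.card_range]
  rw [← Nat.cast_smul_eq_nsmul ℂ, inv_smul_smul₀ (Nat.cast_ne_zero.2 hk)]

theorem cesaro_starSec (g : ∀ x, E x →L[ℂ] E x) (k : ℕ) :
    cesaro D m (starSec g) k = starSec (cesaro D m g k) := by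
  have h1 : ∀ j, (transfer D m)^[j] (starSec g) = starSec ((transfer D m)^[j] g) := by
    intro j
    induction j with
    | zero => rfl
    | succ j ih => rw [Function.iterate_succ_apply', ih, transfer_starSec,
        Function.iterate_succ_apply']
  funext x
  simp only [cesaro, h1, starSec, map_sum, map_smulₛₗ, map_inv₀, map_natCast]

/-- The Cesàro means of a coboundary telescope. -/
theorem cesaro_sub_transfer (ψ : ∀ x, E x →L[ℂ] E x) (k : ℕ) :
    cesaro D m (ψ - transfer D m ψ) k =
      (k : ℂ)⁻¹ • (transfer D m ψ - (transfer D m)^[k + 1] ψ) := by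
  have h1 : ψ - transfer D m ψ = (1 - transferL D m) ψ := rfl
  rw [cesaro_eq_transferL, h1, ← Module.End.mul_apply, smul_mul_assoc, mul_assoc,
    geom_sum_mul_neg, LinearMap.smul_apply, mul_sub, mul_one, ← pow_succ', LinearMap.sub_apply,
    transferL_pow_apply]
  rfl

/-- The difference of `g` and a Cesàro mean of `g` is a coboundary. -/
theorem exists_sub_cesaro_eq (g : ∀ x, E x →L[ℂ] E x) {n : ℕ} (hn : n ≠ 0) :
    ∃ ψ : Module.End ℂ (∀ x, E x →L[ℂ] E x), ψ ∈ Submodule.span ℂ (Set.range fun j =>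
      transferL D m ^ j) ∧ g - cesaro D m g n = ψ g - transfer D m (ψ g) := by
  refine ⟨(n : ℂ)⁻¹ • ∑ j ∈ Finset.range n, ∑ i ∈ Finset.range (j + 1), transferL D m ^ i,
    Submodule.smul_mem _ _ (Submodule.sum_mem _ fun j _ => Submodule.sum_mem _ fun i _ =>
      Submodule.subset_span ⟨i, rfl⟩), ?_⟩
  set ψ : Module.End ℂ (∀ x, E x →L[ℂ] E x) :=
    (n : ℂ)⁻¹ • ∑ j ∈ Finset.range n, ∑ i ∈ Finset.range (j + 1), transferL D m ^ i with hψ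
  have h1 : (1 - transferL D m) * ψ =
      1 - (n : ℂ)⁻¹ • (transferL D m * ∑ j ∈ Finset.range n, transferL D m ^ j) := by
    rw [hψ, mul_smul_comm, Finset.mul_sum]
    simp only [mul_neg_geom_sum]
    rw [Finset.sum_sub_distrib, smul_sub, Finset.sum_const, Finset.card_range,
      ← Nat.cast_smul_eq_nsmul ℂ, inv_smul_smul₀ (Nat.cast_ne_zero.2 hn), Finset.mul_sum]
    simp only [pow_succ']
  have h2 := congrArg (fun T : Module.End ℂ (∀ x, E x →L[ℂ] E x) => T g) h1
  rw [cesaro_eq_transferL]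
  exact h2.symm

end Algebra

/-- Polynomials in the transfer operator are bounded, since the operator is power bounded. -/
theorem FormBound.exists_apply_of_mem_span (hh : MatrixTransfer.transfer D m h = h)
    {N : ℝ} (hN : 0 ≤ N) (hg : FormBound h g N) {ψ : Module.End ℂ (∀ x, E x →L[ℂ] E x)}
    (hψ : ψ ∈ Submodule.span ℂ (Set.range fun j => transferL D m ^ j)) :
    ∃ B ≥ 0, FormBound h (ψ g) B := by
  induction hψ using Submodule.span_induction with
  | mem T hT =>
    obtain ⟨j, rfl⟩ := hT
    refine ⟨N, hN, ?_⟩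
    change FormBound h ((transferL D m ^ j) g) N
    rw [transferL_pow_apply]
    exact hg.transfer_iterate hh j
  | zero => exact ⟨0, le_rfl, FormBound.zero⟩
  | add S T _ _ hS hT =>
    obtain ⟨a, ha, hS⟩ := hS
    obtain ⟨b, hb, hT⟩ := hT
    exact ⟨a + b, by positivity, hS.add hT⟩
  | smul r T _ hT =>
    obtain ⟨a, ha, hT⟩ := hT
    exact ⟨‖r‖ * a, by positivity, hT.smul r⟩

theorem FormBound.cesaro (hpos : ∀ x, (h x).IsPositive)
    (hh : MatrixTransfer.transfer D m h = h) {N : ℝ}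
    (hN : 0 ≤ N) (hg : FormBound h g N) (k : ℕ) :
    FormBound h (MatrixTransfer.cesaro D m g k) N := by
  rw [cesaro_eq]
  have h1 := (FormBound.sum (Finset.range k) fun j _ => hg.transfer_iterate hh (j + 1)).smul
    (k : ℂ)⁻¹
  refine h1.mono hpos ?_
  rw [norm_inv, Complex.norm_natCast, Finset.card_range, ← mul_assoc]
  exact mul_le_of_le_one_left hN inv_mul_le_one

theorem OscBound.cesaro [IsIsometricSMul G Y] {𝒞 : FiniteCover 𝒜} {C η ε L : ℝ} (hC0 : 0 < C)
    (hC : Comparable 𝒞 h C) (hε : 0 ≤ ε) (hL : 0 ≤ L)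
    (hg : ∀ j, OscBound 𝒞 h ((transfer D m)^[j] g) η ε L) (k : ℕ) :
    OscBound 𝒞 h (MatrixTransfer.cesaro D m g k) η ε L := by
  rw [cesaro_eq]
  have h1 := (OscBound.sum (Finset.range k) fun j _ => hg (j + 1)).smul (k : ℂ)⁻¹
  refine h1.mono hC0 hC le_rfl ?_ ?_
  all_goals
    rw [norm_inv, Complex.norm_natCast, Finset.card_range, ← mul_assoc]
    exact mul_le_of_le_one_left ‹_› inv_mul_le_one

theorem tendsto_of_formBound {φ : ℕ → ∀ x, E x →L[ℂ] E x}
    (hφ : ∀ ε > 0, ∃ M, ∀ k ≥ M, FormBound h (φ k - f) ε) (x : Base G Y) :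
    Tendsto (fun k => φ k x) atTop (𝓝 (f x)) := by
  rw [Metric.tendsto_atTop]
  intro ε hε
  obtain ⟨M, hM⟩ := hφ (ε / (‖h x‖ + 1)) (by positivity)
  refine ⟨M, fun k hk => ?_⟩
  rw [dist_eq_norm]
  have h1 : ‖φ k x - f x‖ ≤ _ := (hM k hk).norm_le_mul (by positivity) x
  refine h1.trans_lt ?_
  rw [div_mul_eq_mul_div, div_lt_iff₀ (by positivity)]
  linarith

namespace HarmonicSetup

variable [IsIsometricSMul G Y] [CompactSpace (Base G Y)] [LocallyCompactSpace Y]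

/-- The Cesàro means have a uniform cluster point, which is harmonic. Pointwise cluster points exist
since the fibres are finite-dimensional; the common modulus of continuity makes the convergence
uniform. -/
theorem exists_cluster (H : HarmonicSetup D 𝒜 m h) (hg : IsBundleEnd F E g) :
    ∃ f : ∀ x, E x →L[ℂ] E x, IsBundleEnd F E f ∧ transfer D m f = f ∧
      ∀ ε > 0, ∃ n, n ≠ 0 ∧ FormBound h (cesaro D m g n - f) ε := by
  obtain ⟨𝒞⟩ := exists_finiteCover 𝒜
  obtain ⟨C, hC0, hC⟩ := H.exists_comparable 𝒞
  obtain ⟨N, hN, hgN⟩ := H.exists_formBound hg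
  obtain ⟨L, hL, hosc⟩ := H.exists_oscBound_iterate hC0 hC hg hN hgN
  obtain ⟨δ, hδ, hδr⟩ := 𝒞.exists_le_rad
  set U : Ultrafilter ℕ := Ultrafilter.of atTop with hU
  have hUle : (U : Filter ℕ) ≤ atTop := Ultrafilter.of_le atTop
  have hAN : ∀ k, FormBound h (cesaro D m g k) N := hgN.cesaro H.pos H.harmonic hN
  have hlim : ∀ x, ∃ T : E x →L[ℂ] E x, Tendsto (fun k => cesaro D m g k x) U (𝓝 T) := by
    intro x
    have := finiteDimensional_fiber F (E := E) x
    have : ProperSpace (E x →L[ℂ] E x) := FiniteDimensional.proper ℂ _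
    obtain ⟨T, -, hT⟩ := (isCompact_closedBall (0 : E x →L[ℂ] E x)
      (N * ‖h x‖)).ultrafilter_le_nhds (U.map fun k => cesaro D m g k x) (by
        rw [le_principal_iff, Ultrafilter.mem_coe, Ultrafilter.mem_map]
        exact univ_mem' fun k => mem_closedBall_zero_iff.2 ((hAN k).norm_le_mul hN x))
    exact ⟨T, hT⟩
  choose f hf using hlim
  have hfosc : ∀ ε > 0, ∃ η > 0, OscBound 𝒞 h f η ε L ∧
      ∀ k, OscBound 𝒞 h (cesaro D m g k) η ε L := by
    intro ε hε
    obtain ⟨η, hη, h1⟩ := hosc ε hε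
    have h2 := OscBound.cesaro hC0 hC (le_of_lt hε) hL h1
    exact ⟨η, hη, OscBound.of_tendsto (Eventually.of_forall h2) hf, h2⟩
  have hunif : ∀ ε > 0, ∀ᶠ k in (U : Filter ℕ), FormBound h (cesaro D m g k - f) ε := by
    intro ε hε
    obtain ⟨η, hη, h1, h2⟩ := hfosc (ε / 6) (by positivity)
    set ρ := min (min η δ) (ε / 3 / (2 * L + 1)) with hρdef
    have hρ : 0 < ρ := lt_min (lt_min hη hδ) (by positivity)
    obtain ⟨s, hs⟩ := exists_finite_centers (G := G) (fun _ : Y => ρ) (fun _ => hρ)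
    have h3 : ∀ᶠ k in (U : Filter ℕ), ∀ z ∈ s, ∀ u v : E (proj G z),
        ‖inner ℂ v ((cesaro D m g k - f) (proj G z) u)‖ ≤
          ε / 3 / C ^ 2 * ((quad h u + quad h v) / 2) := by
      refine (eventually_all_finset s).2 fun z _ => ?_
      obtain ⟨c, hc, hz⟩ := 𝒞.exists_mem_small (proj G z)
      have h4 : Tendsto (fun k => ‖gramOp (𝒞.triv c) (cesaro D m g k - f) (proj G z)‖) U
          (𝓝 0) := by
        have h5 : Tendsto (fun k => cesaro D m g k (proj G z) - f (proj G z)) U (𝓝 0) := by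
          have := (hf (proj G z)).sub_const (f (proj G z))
          rwa [sub_self] at this
        have h6 : Continuous (fun T : E (proj G z) →L[ℂ] E (proj G z) =>
            ‖(ContinuousLinearMap.adjoint ((𝒞.triv c).symmL ℂ (proj G z))).comp
              (T.comp ((𝒞.triv c).symmL ℂ (proj G z)))‖) := by fun_prop
        have h7 := (h6.tendsto 0).comp h5
        simp only [ContinuousLinearMap.zero_comp, ContinuousLinearMap.comp_zero, norm_zero] at h7
        exact h7
      filter_upwards [h4.eventually_le_const (u := ε / 3 / C ^ 2 / C) (by positivity)] with k hk u v
      have h8 := norm_inner_le_of_norm_gramOp_le (by positivity) hC hc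
        (𝒞.small_subset_large c hz) hk u v
      rwa [div_mul_cancel₀ _ hC0.ne'] at h8
    filter_upwards [h3] with k hk
    have h9 : OscBound 𝒞 h (cesaro D m g k - f) η (ε / 6 + ε / 6) (L + L) := by
      have h10 := (h2 k).add (h1.smul (-1))
      rw [neg_one_smul, ← sub_eq_add_neg, norm_neg, norm_one, one_mul, one_mul] at h10
      exact h10
    refine (h9.formBound_of_net hC0 hC (by positivity)
      ((min_le_left _ _).trans (min_le_left _ _))
      (fun c hc => ((min_le_left _ _).trans (min_le_right _ _)).trans (hδr c hc))
      (by positivity) (s := s) hs hk).mono H.pos ?_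
    have h11 : (L + L) * ρ ≤ ε / 3 := by
      calc (L + L) * ρ ≤ (2 * L + 1) * (ε / 3 / (2 * L + 1)) :=
            mul_le_mul (by linarith) (min_le_right _ _) hρ.le (by positivity)
        _ = ε / 3 := by field_simp
    rw [div_mul_cancel₀ _ (by positivity)]
    linarith
  refine ⟨f, isBundleEnd_of_oscBound (h := h) (𝒞 := 𝒞) H.metric fun ε hε => ?_, ?_,
    fun ε hε => ?_⟩
  · obtain ⟨η, hη, h1, -⟩ := hfosc ε hε
    exact ⟨η, hη, L, h1⟩
  · rw [← sub_eq_zero]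
    refine FormBound.eq_zero_of_forall (h := h) fun ε hε => ?_
    have h1 : Tendsto (fun k : ℕ => (k : ℝ)⁻¹ * (N + N)) U (𝓝 (0 * (N + N))) :=
      (tendsto_inv_atTop_nhds_zero_nat.mul_const _).mono_left hUle
    rw [zero_mul] at h1
    obtain ⟨k, hk1, hk2⟩ := ((hunif (ε / 3) (by positivity)).and
      (h1.eventually_le_const (u := ε / 3) (by positivity))).exists
    -- `R A_k g - A_k g` telescopes
    have h2 : FormBound h (transfer D m (cesaro D m g k) - cesaro D m g k) (ε / 3) := by
      have h3 := (((hgN.transfer_iterate H.harmonic (k + 1)).sub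
        (hgN.transfer_iterate H.harmonic 1)).smul (k : ℂ)⁻¹)
      refine FormBound.mono H.pos (a := ‖(k : ℂ)⁻¹‖ * (N + N)) ?_ ?_
      · convert h3 using 1
        have h4 := cesaro_sub_transfer (D := D) (m := m) g k
        rw [cesaro_sub] at h4
        have h5 : MatrixTransfer.cesaro D m (transfer D m g) k =
            transfer D m (cesaro D m g k) := by
          rw [cesaro_eq_transferL, cesaro_eq_transferL, ← transferL_apply, ← transferL_apply,
            ← Module.End.mul_apply, ← Module.End.mul_apply, smul_mul_assoc, mul_smul_comm]
          congr 2
          exact ((Commute.refl _).mul_right (Commute.sum_right _ _ _ fun j _ =>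
            (Commute.refl _).pow_right j)).eq.symm
        rw [h5] at h4
        rw [← neg_sub (cesaro D m g k), h4, ← smul_neg, neg_sub]
        rfl
      · rwa [norm_inv, Complex.norm_natCast]
    have h6 := ((hk1.transfer H.harmonic).neg.add h2).add hk1
    refine FormBound.mono H.pos (a := ε / 3 + ε / 3 + ε / 3) ?_ (by linarith)
    convert h6 using 1
    rw [← transferL_apply, ← transferL_apply, ← transferL_apply, map_sub]
    abel
  · obtain ⟨n, h1, h2⟩ := ((hunif ε hε).and (hUle (eventually_ne_atTop 0))).exists
    exact ⟨n, h2, h1⟩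

/-- The mean ergodic theorem for the transfer operator: as `g - A_n g` is a coboundary, its Cesàro
means tend to zero, while those of `A_n g - f` are as small as `A_n g - f` itself. Thus the uniform
cluster point `f` is the limit. -/
theorem exists_cesaro_limit (H : HarmonicSetup D 𝒜 m h) (hg : IsBundleEnd F E g) :
    ∃ f : ∀ x, E x →L[ℂ] E x, IsBundleEnd F E f ∧ transfer D m f = f ∧
      ∀ ε > 0, ∃ M, ∀ k ≥ M, FormBound h (cesaro D m g k - f) ε := by
  obtain ⟨f, hf, hRf, hcl⟩ := H.exists_cluster hg
  obtain ⟨N, hN, hgN⟩ := H.exists_formBound hg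
  refine ⟨f, hf, hRf, fun ε hε => ?_⟩
  obtain ⟨n, hn, h1⟩ := hcl (ε / 2) (by positivity)
  obtain ⟨ψ, hψ, h2⟩ := exists_sub_cesaro_eq (D := D) (m := m) g hn
  obtain ⟨B, hB, hψB⟩ := hgN.exists_apply_of_mem_span H.harmonic hN hψ
  have h3 : Tendsto (fun k : ℕ => (k : ℝ)⁻¹ * (B + B)) atTop (𝓝 (0 * (B + B))) :=
    tendsto_inv_atTop_nhds_zero_nat.mul_const _
  rw [zero_mul] at h3
  obtain ⟨M, hM⟩ := eventually_atTop.1 ((h3.eventually_le_const (u := ε / 2)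
    (by positivity)).and (eventually_ne_atTop 0))
  refine ⟨M, fun k hk => ?_⟩
  obtain ⟨h4, hk0⟩ := hM k hk
  have h5 : cesaro D m g k - f = cesaro D m (ψ g - transfer D m (ψ g)) k +
      cesaro D m (cesaro D m g n - f) k := by
    rw [← h2, ← cesaro_add, sub_add_sub_cancel, cesaro_sub, cesaro_of_fixed hRf hk0]
  have h6 : FormBound h (cesaro D m (ψ g - transfer D m (ψ g)) k) (ε / 2) := by
    rw [cesaro_sub_transfer]
    refine (((hψB.transfer H.harmonic).sub
      (hψB.transfer_iterate H.harmonic (k + 1))).smul (k : ℂ)⁻¹).mono H.pos ?_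
    rwa [norm_inv, Complex.norm_natCast]
  rw [h5]
  exact (h6.add (h1.cesaro H.pos H.harmonic (by positivity) k)).mono H.pos (by linarith)

theorem cesaroProj_spec (H : HarmonicSetup D 𝒜 m h) (hg : IsBundleEnd F E g) :
    IsBundleEnd F E (cesaroProj D m g) ∧ transfer D m (cesaroProj D m g) = cesaroProj D m g ∧
      ∀ ε > 0, ∃ M, ∀ k ≥ M, FormBound h (cesaro D m g k - cesaroProj D m g) ε := by
  obtain ⟨f, hf, hRf, hlim⟩ := H.exists_cesaro_limit hg
  have h1 : cesaroProj D m g = f := funext fun x => (tendsto_of_formBound hlim x).limUnder_eq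
  rw [h1]
  exact ⟨hf, hRf, hlim⟩

theorem tendsto_cesaro (H : HarmonicSetup D 𝒜 m h) (hg : IsBundleEnd F E g) (x : Base G Y) :
    Tendsto (fun k => cesaro D m g k x) atTop (𝓝 (cesaroProj D m g x)) :=
  tendsto_of_formBound (H.cesaroProj_spec hg).2.2 x

theorem cesaro_uniform (H : HarmonicSetup D 𝒜 m h) (hg : IsBundleEnd F E g) {ε : ℝ} (hε : 0 < ε) :
    ∃ M, ∀ k ≥ M, ∀ x, ‖cesaro D m g k x - cesaroProj D m g x‖ < ε := by
  obtain ⟨B, hB, h1⟩ := H.exists_norm_le H.isEnd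
  obtain ⟨M, hM⟩ := (H.cesaroProj_spec hg).2.2 (ε / (B + 1)) (by positivity)
  refine ⟨M, fun k hk x => ?_⟩
  have h2 : ‖cesaro D m g k x - cesaroProj D m g x‖ ≤ _ :=
    (hM k hk).norm_le_mul (by positivity) x
  refine h2.trans_lt ?_
  calc ε / (B + 1) * ‖h x‖ ≤ ε / (B + 1) * B := by gcongr; exact h1 x
    _ < ε / (B + 1) * (B + 1) := by gcongr; linarith
    _ = ε := by field_simp

end HarmonicSetup

end Ergodic

/-! ### Complete positivity and the twisted product -/

section BlockPositivity

variable {X : Type*} {E : X → Type*} [∀ x, NormedAddCommGroup (E x)]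
  [∀ x, InnerProductSpace ℂ (E x)] {h f g : ∀ x, E x →L[ℂ] E x}

/-- The block matrix `[[P, b*], [b, Q]]` is positive: its quadratic form on pairs `(u, v)` of
vectors in the same fibre is nonnegative. Only real parts are taken, so that `P` and `Q` need not be
self-adjoint. -/
def BlockPos (P b Q : ∀ x, E x →L[ℂ] E x) : Prop :=
  ∀ (x : X) (u v : E x),
    0 ≤ (inner ℂ u (P x u)).re + 2 * (inner ℂ v (b x u)).re + (inner ℂ v (Q x v)).re

variable {P b Q P' b' Q' : ∀ x, E x →L[ℂ] E x}

theorem BlockPos.zero : BlockPos (0 : ∀ x, E x →L[ℂ] E x) 0 0 := fun x u v => by simp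

theorem BlockPos.add (h₁ : BlockPos P b Q) (h₂ : BlockPos P' b' Q') :
    BlockPos (P + P') (b + b') (Q + Q') := fun x u v => by
  have h3 := h₁ x u v
  have h4 := h₂ x u v
  simp only [Pi.add_apply, add_apply, inner_add_right, Complex.add_re]
  linarith

theorem BlockPos.smul (h₁ : BlockPos P b Q) {r : ℝ} (hr : 0 ≤ r) :
    BlockPos ((r : ℂ) • P) ((r : ℂ) • b) ((r : ℂ) • Q) := fun x u v => by
  have h3 := mul_nonneg hr (h₁ x u v)
  simp only [Pi.smul_apply, smul_apply, inner_smul_right, Complex.re_ofReal_mul]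
  linarith

theorem BlockPos.of_tendsto {ι : Type*} {l : Filter ι} [l.NeBot]
    {P' b' Q' : ι → ∀ x, E x →L[ℂ] E x} (hpos : ∀ i, BlockPos (P' i) (b' i) (Q' i))
    (hP : ∀ x, Tendsto (fun i => P' i x) l (𝓝 (P x)))
    (hb : ∀ x, Tendsto (fun i => b' i x) l (𝓝 (b x)))
    (hQ : ∀ x, Tendsto (fun i => Q' i x) l (𝓝 (Q x))) : BlockPos P b Q := fun x u v => by
  have h1 : ∀ {S' : ι → ∀ x, E x →L[ℂ] E x} {S : ∀ x, E x →L[ℂ] E x} (u v : E x),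
      (∀ x, Tendsto (fun i => S' i x) l (𝓝 (S x))) →
      Tendsto (fun i => (inner ℂ v (S' i x u)).re) l (𝓝 (inner ℂ v (S x u)).re) :=
    fun u v hS => (Complex.continuous_re.tendsto _).comp (Tendsto.inner tendsto_const_nhds
      (((ContinuousLinearMap.apply ℂ (E x) u).continuous.tendsto _).comp (hS x)))
  exact ge_of_tendsto' (((h1 u u hP).add ((h1 u v hb).const_mul 2)).add (h1 v v hQ))
    fun i => hpos i x u v

theorem BlockPos.re_inner_nonneg (h₁ : BlockPos P 0 0) (x : X) (u : E x) :
    0 ≤ (inner ℂ u (P x u)).re := by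
  simpa using h₁ x u 0

variable (h) in
/-- The pointwise product `f h⁻¹ g`. -/
def twist (f g : ∀ x, E x →L[ℂ] E x) (x : X) : E x →L[ℂ] E x := f x * Ring.inverse (h x) * g x

theorem twist_add_left (f f' g : ∀ x, E x →L[ℂ] E x) :
    twist h (f + f') g = twist h f g + twist h f' g := by
  funext x; simp [twist, add_mul]

theorem twist_add_right (f g g' : ∀ x, E x →L[ℂ] E x) :
    twist h f (g + g') = twist h f g + twist h f g' := by
  funext x; simp [twist, mul_add]

theorem twist_smul_left (r : ℂ) (f g : ∀ x, E x →L[ℂ] E x) :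
    twist h (r • f) g = r • twist h f g := by
  funext x; simp [twist]

theorem twist_smul_right (r : ℂ) (f g : ∀ x, E x →L[ℂ] E x) :
    twist h f (r • g) = r • twist h f g := by
  funext x; simp [twist]

theorem twist_assoc (f g k : ∀ x, E x →L[ℂ] E x) :
    twist h (twist h f g) k = twist h f (twist h g k) := by
  funext x; simp only [twist, mul_assoc]

theorem twist_self_left (hu : ∀ x, IsUnit (h x)) (f : ∀ x, E x →L[ℂ] E x) : twist h h f = f := by
  funext x; rw [twist, Ring.mul_inverse_cancel _ (hu x), one_mul]

theorem twist_self_right (hu : ∀ x, IsUnit (h x)) (f : ∀ x, E x →L[ℂ] E x) :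
    twist h f h = f := by
  funext x; rw [twist, mul_assoc, Ring.inverse_mul_cancel _ (hu x), mul_one]

variable [∀ x, CompleteSpace (E x)]

theorem starSec_starSec (f : ∀ x, E x →L[ℂ] E x) : starSec (starSec f) = f := by
  funext x; exact ContinuousLinearMap.adjoint_adjoint _

theorem starSec_add (f g : ∀ x, E x →L[ℂ] E x) : starSec (f + g) = starSec f + starSec g := by
  funext x; exact map_add _ _ _

theorem starSec_smul (r : ℂ) (f : ∀ x, E x →L[ℂ] E x) :
    starSec (r • f) = starRingEnd ℂ r • starSec f := by
  funext x; exact star_smul r (f x)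

theorem isSelfAdjoint_inverse (hpos : ∀ x, (h x).IsPositive) (x : X) :
    star (Ring.inverse (h x)) = Ring.inverse (h x) := by
  rw [← Ring.inverse_star, (hpos x).isSelfAdjoint.star_eq]

theorem starSec_twist (hpos : ∀ x, (h x).IsPositive) (f g : ∀ x, E x →L[ℂ] E x) :
    starSec (twist h f g) = twist h (starSec g) (starSec f) := by
  funext x
  change star (f x * Ring.inverse (h x) * g x) = star (g x) * Ring.inverse (h x) * star (f x)
  rw [star_mul, star_mul, isSelfAdjoint_inverse hpos, mul_assoc]

theorem inner_twist_starSec (hpos : ∀ x, (h x).IsPositive) (f g : ∀ x, E x →L[ℂ] E x) (x : X)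
    (u v : E x) : inner ℂ v (twist h (starSec f) g x u) =
      inner ℂ (Ring.inverse (h x) (f x v)) (g x u) := by
  rw [twist, mul_apply_eq_comp, mul_apply_eq_comp, starSec, ContinuousLinearMap.adjoint_inner_right,
    ← ContinuousLinearMap.adjoint_inner_left]
  congr 2
  exact isSelfAdjoint_inverse hpos x

theorem inverse_apply_apply (hu : ∀ x, IsUnit (h x)) (x : X) (u : E x) :
    h x (Ring.inverse (h x) u) = u := by
  rw [← mul_apply_eq_comp, Ring.mul_inverse_cancel _ (hu x)]; rfl

/-- The quadratic form of the block matrix is the square of `h^(-1/2) b u + h^(1/2) v`, i.e. `h`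
evaluated at `h⁻¹ b u + v`. -/
theorem blockPos_twist (hpos : ∀ x, (h x).IsPositive) (hu : ∀ x, IsUnit (h x))
    (b : ∀ x, E x →L[ℂ] E x) : BlockPos (twist h (starSec b) b) b h := fun x u v => by
  have h1 := quad_nonneg hpos (Ring.inverse (h x) (b x u) + v)
  rw [quad, map_add, inverse_apply_apply hu, inner_add_left, inner_add_right, inner_add_right,
    Complex.add_re, Complex.add_re, Complex.add_re, ← inner_twist_starSec hpos] at h1
  have h2 : inner ℂ (Ring.inverse (h x) (b x u)) (h x v) = inner ℂ (b x u) v := by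
    rw [← (hpos x).inner_left_eq_inner_right, inverse_apply_apply hu]
  have h3 : (inner ℂ (b x u) v).re = (inner ℂ v (b x u)).re := by
    rw [← inner_conj_symm, Complex.conj_re]
  rw [h2, h3] at h1
  linarith

/-- The Schwarz inequality `P ≥ b* h⁻¹ b` contained in the positivity of `[[P, b*], [b, h]]`. -/
theorem BlockPos.schwarz (hpos : ∀ x, (h x).IsPositive) (hu : ∀ x, IsUnit (h x))
    (h₁ : BlockPos P b h) : BlockPos (P - twist h (starSec b) b) 0 0 := fun x u v => by
  have h2 := h₁ x u (-Ring.inverse (h x) (b x u))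
  rw [map_neg, inverse_apply_apply hu, inner_neg_left, inner_neg_left, inner_neg_right,
    ← inner_twist_starSec hpos] at h2
  simp only [Pi.sub_apply, Pi.zero_apply, sub_apply, inner_sub_right, Complex.sub_re,
    zero_apply, inner_zero_right, Complex.zero_re, Complex.neg_re] at h2 ⊢
  linarith

end BlockPositivity

section ChoiEffros

variable {G Y : Type*} [Group G] [MulAction G Y] [MetricSpace Y] {D : Dilation G Y}
  {F : Type*} [NormedAddCommGroup F] [InnerProductSpace ℂ F] [CompleteSpace F]
  [FiniteDimensional ℂ F]
  {E : Base G Y → Type*} [∀ x, NormedAddCommGroup (E x)] [∀ x, InnerProductSpace ℂ (E x)]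
  [∀ x, CompleteSpace (E x)] [TopologicalSpace (TotalSpace F E)] [FiberBundle F E]
  [VectorBundle ℂ F E] {𝒜 : LipschitzAtlas F E}
  {m : ∀ x, E (D.baseMap x) →L[ℂ] E x} {h f g : ∀ x, E x →L[ℂ] E x}
  {P b Q : ∀ x, E x →L[ℂ] E x}

theorem BlockPos.transfer (h₁ : BlockPos P b Q) :
    BlockPos (transfer D m P) (transfer D m b) (transfer D m Q) := fun x => by
  induction x using Quotient.inductionOn with
  | h y =>
    intro u v
    change E (proj G y) at u v
    change 0 ≤ (inner ℂ u (MatrixTransfer.transfer D m P (proj G y) u)).re +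
      2 * (inner ℂ v (MatrixTransfer.transfer D m b (proj G y) u)).re +
      (inner ℂ v (MatrixTransfer.transfer D m Q (proj G y) v)).re
    rw [inner_transfer_proj, inner_transfer_proj, inner_transfer_proj, Complex.re_sum,
      Complex.re_sum, Complex.re_sum, Finset.mul_sum, ← Finset.sum_add_distrib,
      ← Finset.sum_add_distrib]
    exact Finset.sum_nonneg fun i _ => h₁ _ _ _

theorem BlockPos.cesaro (h₁ : BlockPos P b Q) (k : ℕ) :
    BlockPos (cesaro D m P k) (cesaro D m b k) (cesaro D m Q k) := by
  have h2 : ∀ j, BlockPos ((MatrixTransfer.transfer D m)^[j] P)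
      ((MatrixTransfer.transfer D m)^[j] b) ((MatrixTransfer.transfer D m)^[j] Q) := by
    intro j
    induction j with
    | zero => exact h₁
    | succ j ih => simp only [Function.iterate_succ_apply']; exact ih.transfer
  have h3 : ∀ n, BlockPos (∑ j ∈ Finset.range n, (MatrixTransfer.transfer D m)^[j + 1] P)
      (∑ j ∈ Finset.range n, (MatrixTransfer.transfer D m)^[j + 1] b)
      (∑ j ∈ Finset.range n, (MatrixTransfer.transfer D m)^[j + 1] Q) := by
    intro n
    induction n with
    | zero => exact BlockPos.zero
    | succ n ih => simp only [Finset.sum_range_succ]; exact ih.add (h2 (n + 1))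
  have h4 := (h3 k).smul (r := (k : ℝ)⁻¹) (by positivity)
  rw [cesaro_eq, cesaro_eq, cesaro_eq]
  simpa only [Complex.ofReal_inv, Complex.ofReal_natCast] using h4

theorem IsBundleEnd.add (hmetric : IsHermitianMetric F E) (hf : IsBundleEnd F E f)
    (hg : IsBundleEnd F E g) : IsBundleEnd F E (f + g) :=
  isBundleEnd_of_continuousAt_matOp fun x₀ => ⟨trivializationAt F E x₀, inferInstance,
    mem_baseSet_trivializationAt F E x₀, by
    have hx := mem_baseSet_trivializationAt F E x₀
    have h1 := (hf.continuousAt_matOp hmetric _ hx).add (hg.continuousAt_matOp hmetric _ hx)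
    refine h1.congr (Eventually.of_forall fun x => ?_)
    ext u; simp [matOp]⟩

theorem IsBundleEnd.smul (hmetric : IsHermitianMetric F E) (r : ℂ) (hf : IsBundleEnd F E f) :
    IsBundleEnd F E (r • f) :=
  isBundleEnd_of_continuousAt_matOp fun x₀ => ⟨trivializationAt F E x₀, inferInstance,
    mem_baseSet_trivializationAt F E x₀, by
    have hx := mem_baseSet_trivializationAt F E x₀
    have h1 := (hf.continuousAt_matOp hmetric _ hx).const_smul r
    refine h1.congr (Eventually.of_forall fun x => ?_)
    ext u; simp [matOp]⟩

theorem eq_zero_of_forall_le_add_re {α : ℝ} {β : ℂ} (hβ : ∀ z : ℂ, 0 ≤ α + 2 * (z * β).re) :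
    β = 0 := by
  by_contra h0
  have h1 : 0 < Complex.normSq β := Complex.normSq_pos.2 h0
  have h2 := hβ (-(((α + 1) / Complex.normSq β : ℝ) : ℂ) * starRingEnd ℂ β)
  rw [neg_mul, neg_mul, mul_assoc, ← Complex.normSq_eq_conj_mul_self, ← Complex.ofReal_mul,
    div_mul_cancel₀ _ h1.ne', Complex.neg_re, Complex.ofReal_re] at h2
  have h3 := hβ 0
  simp only [zero_mul, Complex.zero_re] at h3
  linarith

namespace HarmonicSetup

variable [IsIsometricSMul G Y] [CompactSpace (Base G Y)] [LocallyCompactSpace Y]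

theorem isBundleEnd_twist (H : HarmonicSetup D 𝒜 m h) (hf : IsBundleEnd F E f)
    (hg : IsBundleEnd F E g) : IsBundleEnd F E (twist h f g) :=
  (hf.mul (H.isEnd.inverse H.metric H.isUnit)).mul hg

theorem isBundleEnd_starSec (H : HarmonicSetup D 𝒜 m h) (hf : IsBundleEnd F E f) :
    IsBundleEnd F E (starSec f) := by
  obtain ⟨𝒞⟩ := exists_finiteCover 𝒜
  obtain ⟨C, hC0, hC⟩ := H.exists_comparable 𝒞
  refine isBundleEnd_of_oscBound (𝒞 := 𝒞) (h := h) H.metric fun ε hε => ?_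
  obtain ⟨η, hη, h1⟩ := hf.exists_oscBound H.metric hC0 hC hε
  exact ⟨η, hη, 0, h1.starSec⟩

theorem isBundleEnd_cesaroProj (H : HarmonicSetup D 𝒜 m h) (hg : IsBundleEnd F E g) :
    IsBundleEnd F E (cesaroProj D m g) := (H.cesaroProj_spec hg).1

theorem transfer_cesaroProj (H : HarmonicSetup D 𝒜 m h) (hg : IsBundleEnd F E g) :
    transfer D m (cesaroProj D m g) = cesaroProj D m g := (H.cesaroProj_spec hg).2.1

theorem cesaroProj_of_fixed (H : HarmonicSetup D 𝒜 m h) (hf : IsBundleEnd F E f)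
    (hRf : transfer D m f = f) : cesaroProj D m f = f := by
  funext x
  refine tendsto_nhds_unique (H.tendsto_cesaro hf x) (tendsto_const_nhds.congr' ?_)
  filter_upwards [eventually_ne_atTop 0] with k hk
  rw [cesaro_of_fixed hRf hk]

theorem cesaroProj_cesaroProj (H : HarmonicSetup D 𝒜 m h) (hg : IsBundleEnd F E g) :
    cesaroProj D m (cesaroProj D m g) = cesaroProj D m g :=
  H.cesaroProj_of_fixed (H.isBundleEnd_cesaroProj hg) (H.transfer_cesaroProj hg)

theorem cesaroProj_add (H : HarmonicSetup D 𝒜 m h) (hf : IsBundleEnd F E f)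
    (hg : IsBundleEnd F E g) : cesaroProj D m (f + g) = cesaroProj D m f + cesaroProj D m g := by
  funext x
  refine tendsto_nhds_unique (H.tendsto_cesaro (hf.add H.metric hg) x) ?_
  simp only [cesaro_add]
  exact (H.tendsto_cesaro hf x).add (H.tendsto_cesaro hg x)

theorem cesaroProj_smul (H : HarmonicSetup D 𝒜 m h) (r : ℂ) (hf : IsBundleEnd F E f) :
    cesaroProj D m (r • f) = r • cesaroProj D m f := by
  funext x
  refine tendsto_nhds_unique (H.tendsto_cesaro (hf.smul H.metric r) x) ?_
  simp only [cesaro_smul]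
  exact (H.tendsto_cesaro hf x).const_smul r

theorem cesaroProj_starSec (H : HarmonicSetup D 𝒜 m h) (hf : IsBundleEnd F E f) :
    cesaroProj D m (starSec f) = starSec (cesaroProj D m f) := by
  funext x
  refine tendsto_nhds_unique (H.tendsto_cesaro (H.isBundleEnd_starSec hf) x) ?_
  simp only [cesaro_starSec]
  exact (ContinuousLinearMap.adjoint.continuous.tendsto _).comp (H.tendsto_cesaro hf x)

theorem formBound_cesaroProj (H : HarmonicSetup D 𝒜 m h) (hf : IsBundleEnd F E f) {N : ℝ}
    (hN : 0 ≤ N) (hfN : FormBound h f N) : FormBound h (cesaroProj D m f) N :=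
  FormBound.of_tendsto (l := atTop)
    (Eventually.of_forall (hfN.cesaro H.pos H.harmonic hN)) (H.tendsto_cesaro hf)

theorem blockPos_cesaroProj (H : HarmonicSetup D 𝒜 m h) (hP : IsBundleEnd F E P)
    (hb : IsBundleEnd F E b) (hQ : IsBundleEnd F E Q) (h₁ : BlockPos P b Q) :
    BlockPos (cesaroProj D m P) (cesaroProj D m b) (cesaroProj D m Q) :=
  BlockPos.of_tendsto (l := atTop) h₁.cesaro (H.tendsto_cesaro hP) (H.tendsto_cesaro hb)
    (H.tendsto_cesaro hQ)

/-- The block matrix of `T₁ (b* h⁻¹ b)` and `T₁ b` is positive: `T₁` is a limit of averages of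
compressions, and is thus completely positive. -/
theorem blockPos_cesaroProj_twist (H : HarmonicSetup D 𝒜 m h) (hb : IsBundleEnd F E b) :
    BlockPos (cesaroProj D m (twist h (starSec b) b)) (cesaroProj D m b) h := by
  have h1 := H.blockPos_cesaroProj (H.isBundleEnd_twist (H.isBundleEnd_starSec hb) hb) hb H.isEnd
    (blockPos_twist H.pos H.isUnit b)
  rwa [H.cesaroProj_of_fixed H.isEnd H.harmonic] at h1

/-- The kernel of `T₁` is orthogonal to the harmonic sections. The Schwarz inequality for
`d + z a`, after one more application of `T₁`, has the same terms quadratic in `z` on both sides, so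
that the term linear in `z` must vanish. -/
theorem cesaroProj_twist_eq_zero (H : HarmonicSetup D 𝒜 m h) {d a : ∀ x, E x →L[ℂ] E x}
    (hd : IsBundleEnd F E d) (hTd : cesaroProj D m d = 0) (ha : IsBundleEnd F E a)
    (hRa : transfer D m a = a) : cesaroProj D m (twist h (starSec d) a) = 0 := by
  have hTa := H.cesaroProj_of_fixed ha hRa
  have hd' := H.isBundleEnd_starSec hd
  have ha' := H.isBundleEnd_starSec ha
  set dd := twist h (starSec d) d with hdd
  set da := twist h (starSec d) a with hda
  set ad := twist h (starSec a) d with had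
  set aa := twist h (starSec a) a with haa
  have edd : IsBundleEnd F E dd := H.isBundleEnd_twist hd' hd
  have eda : IsBundleEnd F E da := H.isBundleEnd_twist hd' ha
  have ead : IsBundleEnd F E ad := H.isBundleEnd_twist ha' hd
  have eaa : IsBundleEnd F E aa := H.isBundleEnd_twist ha' ha
  have hTad : cesaroProj D m ad = starSec (cesaroProj D m da) := by
    rw [← H.cesaroProj_starSec eda, hda, starSec_twist H.pos, starSec_starSec]
  have key : ∀ (z : ℂ) (x : Base G Y) (u : E x),
      0 ≤ (inner ℂ u (cesaroProj D m dd x u)).re +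
        2 * (z * inner ℂ u (cesaroProj D m da x u)).re := by
    intro z x u
    set c := d + z • a with hc
    have ec : IsBundleEnd F E c := hd.add H.metric (ha.smul H.metric z)
    have hTc : cesaroProj D m c = z • a := by
      rw [hc, H.cesaroProj_add hd (ha.smul H.metric z), hTd, zero_add, H.cesaroProj_smul z ha, hTa]
    have hcc : twist h (starSec c) c =
        dd + z • da + starRingEnd ℂ z • ad + (starRingEnd ℂ z * z) • aa := by
      rw [hc, starSec_add, starSec_smul, twist_add_left, twist_add_right, twist_add_right,
        twist_smul_left, twist_smul_left, twist_smul_right, twist_smul_right, smul_smul]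
      abel
    have hzz : twist h (starSec (z • a)) (z • a) = (starRingEnd ℂ z * z) • aa := by
      rw [starSec_smul, twist_smul_left, twist_smul_right, smul_smul]
    have e1 := edd.add H.metric (eda.smul H.metric z)
    have e2 := e1.add H.metric (ead.smul H.metric (starRingEnd ℂ z))
    have e3 := eaa.smul H.metric (starRingEnd ℂ z * z)
    have hTcc : cesaroProj D m (twist h (starSec c) c) =
        cesaroProj D m dd + z • cesaroProj D m da + starRingEnd ℂ z • cesaroProj D m ad +
          (starRingEnd ℂ z * z) • cesaroProj D m aa := by
      rw [hcc, H.cesaroProj_add e2 e3, H.cesaroProj_add e1 (ead.smul H.metric _),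
        H.cesaroProj_add edd (eda.smul H.metric _), H.cesaroProj_smul _ eda,
        H.cesaroProj_smul _ ead, H.cesaroProj_smul _ eaa]
    have ecc : IsBundleEnd F E (twist h (starSec c) c) :=
      H.isBundleEnd_twist (H.isBundleEnd_starSec ec) ec
    have h1 := (H.blockPos_cesaroProj_twist ec).schwarz H.pos H.isUnit
    rw [hTc, hzz, sub_eq_add_neg, ← neg_smul] at h1
    have e4 := eaa.smul H.metric (-(starRingEnd ℂ z * z))
    have e5 := H.isBundleEnd_cesaroProj ecc
    have ezero : IsBundleEnd F E (0 : ∀ x, E x →L[ℂ] E x) := by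
      simpa using ha.smul H.metric 0
    have h2 := H.blockPos_cesaroProj (e5.add H.metric e4) ezero ezero h1
    have hT0 : cesaroProj D m (0 : ∀ x, E x →L[ℂ] E x) = 0 :=
      H.cesaroProj_of_fixed ezero (map_zero (transferL D m))
    rw [hT0, H.cesaroProj_add e5 e4, H.cesaroProj_cesaroProj ecc, H.cesaroProj_smul _ eaa, hTcc,
      neg_smul, add_neg_cancel_right] at h2
    have h3 := h2.re_inner_nonneg x u
    simp only [Pi.add_apply, Pi.smul_apply, add_apply, smul_apply, inner_add_right,
      inner_smul_right, Complex.add_re] at h3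
    have h4 : inner ℂ u (cesaroProj D m ad x u) =
        starRingEnd ℂ (inner ℂ u (cesaroProj D m da x u)) := by
      rw [hTad, starSec, ContinuousLinearMap.adjoint_inner_right, inner_conj_symm]
    rw [h4, ← map_mul, Complex.conj_re] at h3
    linarith
  funext x
  have h5 : (cesaroProj D m da x).toLinearMap = 0 := by
    rw [← inner_map_self_eq_zero]
    intro u
    have h6 : inner ℂ u (cesaroProj D m da x u) = 0 :=
      eq_zero_of_forall_le_add_re fun z => key z x u
    rw [← inner_conj_symm]
    exact (congrArg (starRingEnd ℂ) h6).trans (map_zero _)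
  ext u
  exact congrArg (fun T : E x →ₗ[ℂ] E x => T u) h5

theorem cesaroProj_twist_cesaroProj_left (H : HarmonicSetup D 𝒜 m h) {a : ∀ x, E x →L[ℂ] E x}
    (hb : IsBundleEnd F E b) (ha : IsBundleEnd F E a) (hRa : transfer D m a = a) :
    cesaroProj D m (twist h (cesaroProj D m b) a) = cesaroProj D m (twist h b a) := by
  have hTb := H.isBundleEnd_cesaroProj hb
  have hn := hTb.smul H.metric (-1)
  set e := b + (-1 : ℂ) • cesaroProj D m b with he
  have ee : IsBundleEnd F E e := hb.add H.metric hn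
  have hTe : cesaroProj D m e = 0 := by
    rw [he, H.cesaroProj_add hb hn, H.cesaroProj_smul _ hTb, H.cesaroProj_cesaroProj hb,
      neg_one_smul, add_neg_cancel]
  have h1 := H.cesaroProj_twist_eq_zero (H.isBundleEnd_starSec ee)
    (by rw [H.cesaroProj_starSec ee, hTe]; funext x; exact map_zero _) ha hRa
  rw [starSec_starSec, he, twist_add_left, twist_smul_left,
    H.cesaroProj_add (H.isBundleEnd_twist hb ha)
      ((H.isBundleEnd_twist hTb ha).smul H.metric _),
    H.cesaroProj_smul _ (H.isBundleEnd_twist hTb ha), neg_one_smul, ← sub_eq_add_neg,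
    sub_eq_zero] at h1
  exact h1.symm

theorem transfer_starSec_eq (hRf : transfer D m f = f) :
    transfer D m (starSec f) = starSec f := by rw [transfer_starSec, hRf]

theorem cesaroProj_twist_cesaroProj_right (H : HarmonicSetup D 𝒜 m h) {a : ∀ x, E x →L[ℂ] E x}
    (hb : IsBundleEnd F E b) (ha : IsBundleEnd F E a) (hRa : transfer D m a = a) :
    cesaroProj D m (twist h a (cesaroProj D m b)) = cesaroProj D m (twist h a b) := by
  have h1 := H.cesaroProj_twist_cesaroProj_left (H.isBundleEnd_starSec hb)
    (H.isBundleEnd_starSec ha) (transfer_starSec_eq hRa)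
  rw [H.cesaroProj_starSec hb, ← starSec_twist H.pos, ← starSec_twist H.pos,
    H.cesaroProj_starSec (H.isBundleEnd_twist ha (H.isBundleEnd_cesaroProj hb)),
    H.cesaroProj_starSec (H.isBundleEnd_twist ha hb)] at h1
  rw [← starSec_starSec (cesaroProj D m (twist h a (cesaroProj D m b))), h1, starSec_starSec]

end HarmonicSetup

end ChoiEffros

/-! ### The `C*`-algebra of harmonic sections -/

section Norm

variable {X : Type*} {E : X → Type*} [∀ x, NormedAddCommGroup (E x)]
  [∀ x, InnerProductSpace ℂ (E x)] [∀ x, CompleteSpace (E x)] {h f g : ∀ x, E x →L[ℂ] E x}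

theorem exists_sqrt_of_isPositive {V : Type*} [NormedAddCommGroup V] [InnerProductSpace ℂ V]
    [CompleteSpace V] {T : V →L[ℂ] V} (hT : T.IsPositive) (hu : IsUnit T) :
    IsSelfAdjoint (T ^ (-(1 / 2) : ℝ)) ∧ ∃ k : V →L[ℂ] V, IsSelfAdjoint k ∧
      T ^ (-(1 / 2) : ℝ) * k = 1 ∧ k * T ^ (-(1 / 2) : ℝ) = 1 ∧ k * k = T := by
  have h0 : 0 ≤ T := (ContinuousLinearMap.nonneg_iff_isPositive T).2 hT
  refine ⟨IsSelfAdjoint.of_nonneg CFC.rpow_nonneg, T ^ (1 / 2 : ℝ),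
    IsSelfAdjoint.of_nonneg CFC.rpow_nonneg, ?_, ?_, ?_⟩
  · rw [← CFC.rpow_add hu, neg_add_cancel, CFC.rpow_zero T h0]
  · rw [← CFC.rpow_add hu, add_neg_cancel, CFC.rpow_zero T h0]
  · rw [← CFC.rpow_add hu, add_halves, CFC.rpow_one T h0]

variable (h) in
/-- The normalized section `h ^ (-1/2) f h ^ (-1/2)`. -/
def normalized (f : ∀ x, E x →L[ℂ] E x) (x : X) : E x →L[ℂ] E x :=
  (h x) ^ (-(1 / 2) : ℝ) * f x * (h x) ^ (-(1 / 2) : ℝ)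

theorem normalized_twist (hpos : ∀ x, (h x).IsPositive) (hu : ∀ x, IsUnit (h x))
    (f g : ∀ x, E x →L[ℂ] E x) (x : X) :
    normalized h (twist h f g) x = normalized h f x * normalized h g x := by
  obtain ⟨-, k, -, h1, h2, h3⟩ := exists_sqrt_of_isPositive (hpos x) (hu x)
  set s := (h x) ^ (-(1 / 2) : ℝ) with hs
  have h4 : Ring.inverse (h x) = s * s := by
    refine Ring.inverse_unit ⟨h x, s * s, ?_, ?_⟩
    · rw [← h3, mul_assoc, ← mul_assoc k s s, h2, one_mul, h2]
    · rw [← h3, mul_assoc, ← mul_assoc s k k, h1, one_mul, h1]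
  simp only [normalized, twist, h4, ← hs, mul_assoc]

theorem formBound_iff_norm_normalized_le (hpos : ∀ x, (h x).IsPositive) (hu : ∀ x, IsUnit (h x))
    {c : ℝ} (hc : 0 ≤ c) : FormBound h f c ↔ ∀ x, ‖normalized h f x‖ ≤ c := by
  refine forall_congr' fun x => ?_
  obtain ⟨hsa, k, hk, h1, h2, h3⟩ := exists_sqrt_of_isPositive (hpos x) (hu x)
  set s := (h x) ^ (-(1 / 2) : ℝ) with hs
  have hq : ∀ u, quad h u = ‖k u‖ ^ 2 := fun u => by
    rw [quad, ← h3, mul_apply_eq_comp, ← ContinuousLinearMap.adjoint_inner_left, hk.adjoint_eq,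
      inner_self_eq_norm_sq_to_K]
    norm_cast
  have hks : ∀ u, k (s u) = u := fun u => by rw [← mul_apply_eq_comp, h2]; rfl
  have hsk : ∀ u, s (k u) = u := fun u => by rw [← mul_apply_eq_comp, h1]; rfl
  have hin : ∀ u v, inner ℂ v (normalized h f x u) = inner ℂ (s v) (f x (s u)) := fun u v => by
    rw [normalized, ← hs, mul_apply_eq_comp, mul_apply_eq_comp,
      ← ContinuousLinearMap.adjoint_inner_left, hsa.adjoint_eq]
  constructor
  · intro hf
    refine opNorm_le_of_norm_inner_le hc fun u v => ?_
    rw [hin]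
    refine (hf _ _).trans (le_of_eq ?_)
    rw [hq, hq, hks, hks]
  · intro hf u v
    have h4 := hin (k u) (k v)
    rw [hsk, hsk] at h4
    rw [← h4, hq, hq]
    calc ‖inner ℂ (k v) (normalized h f x (k u))‖ ≤ ‖k v‖ * ‖normalized h f x (k u)‖ :=
          norm_inner_le_norm _ _
      _ ≤ ‖k v‖ * (c * ‖k u‖) := by
          gcongr; exact ContinuousLinearMap.le_of_opNorm_le _ hf _
      _ ≤ c * ((‖k u‖ ^ 2 + ‖k v‖ ^ 2) / 2) := by
          nlinarith [mul_nonneg hc (sq_nonneg (‖k u‖ - ‖k v‖))]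

variable (h) in
/-- The norm `‖f‖_h = ‖h ^ (-1/2) f h ^ (-1/2)‖`. -/
def hnorm (f : ∀ x, E x →L[ℂ] E x) : ℝ := ⨆ x, ‖normalized h f x‖

theorem hnorm_nonneg (f : ∀ x, E x →L[ℂ] E x) : 0 ≤ hnorm h f :=
  Real.iSup_nonneg fun _ => norm_nonneg _

theorem FormBound.hnorm_le (hpos : ∀ x, (h x).IsPositive) (hu : ∀ x, IsUnit (h x)) {c : ℝ}
    (hc : 0 ≤ c) (hf : FormBound h f c) : hnorm h f ≤ c :=
  Real.iSup_le ((formBound_iff_norm_normalized_le hpos hu hc).1 hf) hc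

theorem FormBound.formBound_hnorm (hpos : ∀ x, (h x).IsPositive) (hu : ∀ x, IsUnit (h x)) {c : ℝ}
    (hc : 0 ≤ c) (hf : FormBound h f c) : FormBound h f (hnorm h f) := by
  rw [formBound_iff_norm_normalized_le hpos hu (hnorm_nonneg f)]
  intro x
  refine le_ciSup (f := fun x => ‖normalized h f x‖) ⟨c, ?_⟩ x
  rintro _ ⟨x, rfl⟩
  exact (formBound_iff_norm_normalized_le hpos hu hc).1 hf x

theorem FormBound.twist (hpos : ∀ x, (h x).IsPositive) (hu : ∀ x, IsUnit (h x)) {a b : ℝ}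
    (ha : 0 ≤ a) (hb : 0 ≤ b) (hf : FormBound h f a) (hg : FormBound h g b) :
    FormBound h (twist h f g) (a * b) := by
  rw [formBound_iff_norm_normalized_le hpos hu (by positivity)]
  intro x
  rw [normalized_twist hpos hu]
  exact (norm_mul_le _ _).trans (mul_le_mul ((formBound_iff_norm_normalized_le hpos hu ha).1 hf x)
    ((formBound_iff_norm_normalized_le hpos hu hb).1 hg x) (norm_nonneg _) ha)

/-- If `[[P, b*], [b, h]]` is positive and `P ≤ c h`, then `‖b‖_h ^ 2 ≤ c`. -/
theorem BlockPos.formBound {P b : ∀ x, E x →L[ℂ] E x} (h₁ : BlockPos P b h) {c : ℝ}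
    (hc : 0 < c) (hP : FormBound h P c) : FormBound h b (Real.sqrt c) := by
  intro x u v
  set w := inner ℂ v (b x u) with hw
  have hr : 0 < Real.sqrt c := Real.sqrt_pos.2 hc
  have hrr : Real.sqrt c * Real.sqrt c = c := Real.mul_self_sqrt hc.le
  obtain ⟨z, hz, hzw⟩ : ∃ z : ℂ, ‖z‖ = 1 ∧ (z * w).re = -‖w‖ := by
    rcases eq_or_ne w 0 with h0 | h0
    · exact ⟨1, by simp, by simp [h0]⟩
    · have h0' : (‖w‖ : ℂ) ≠ 0 := Complex.ofReal_ne_zero.2 (norm_ne_zero_iff.2 h0)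
      refine ⟨-starRingEnd ℂ w / ‖w‖, ?_, ?_⟩
      · rw [norm_div, norm_neg, RCLike.norm_conj, Complex.norm_real, norm_norm,
          div_self (norm_ne_zero_iff.2 h0)]
      · rw [div_mul_eq_mul_div, neg_mul, ← Complex.normSq_eq_conj_mul_self,
          Complex.normSq_eq_norm_sq, ← Complex.ofReal_neg, ← Complex.ofReal_div, Complex.ofReal_re,
          neg_div, pow_two, mul_self_div_self]
  -- scaling `u` by `c ^ (-1/2)` balances the two diagonal terms
  have h2 := h₁ x (((Real.sqrt c)⁻¹ : ℂ) • z • u) v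
  have h3 : (inner ℂ (((Real.sqrt c)⁻¹ : ℂ) • z • u) (P x (((Real.sqrt c)⁻¹ : ℂ) • z • u))).re ≤
      quad h u := by
    refine (Complex.re_le_norm _).trans ((hP x _ _).trans (le_of_eq ?_))
    rw [quad_smul, quad_smul, hz, norm_inv, Complex.norm_real, Real.norm_of_nonneg hr.le, inv_pow,
      Real.sq_sqrt hc.le]
    field_simp
    ring
  have h4 : (inner ℂ v (b x (((Real.sqrt c)⁻¹ : ℂ) • z • u))).re = -((Real.sqrt c)⁻¹ * ‖w‖) := by
    rw [map_smul, map_smul, inner_smul_right, inner_smul_right, ← hw, ← Complex.ofReal_inv,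
      Complex.re_ofReal_mul, hzw, mul_neg]
  rw [h4] at h2
  change 0 ≤ _ + _ + quad h v at h2
  have h5 : (Real.sqrt c)⁻¹ * ‖w‖ ≤ (quad h u + quad h v) / 2 := by linarith
  rwa [inv_mul_le_iff₀ hr] at h5

end Norm

section Algebra

variable {G Y : Type*} [Group G] [MulAction G Y] [MetricSpace Y] {D : Dilation G Y}
  {F : Type*} [NormedAddCommGroup F] [InnerProductSpace ℂ F] [CompleteSpace F]
  [FiniteDimensional ℂ F]
  {E : Base G Y → Type*} [∀ x, NormedAddCommGroup (E x)] [∀ x, InnerProductSpace ℂ (E x)]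
  [∀ x, CompleteSpace (E x)] [TopologicalSpace (TotalSpace F E)] [FiberBundle F E]
  [VectorBundle ℂ F E] {𝒜 : LipschitzAtlas F E}
  {m : ∀ x, E (D.baseMap x) →L[ℂ] E x} {h : ∀ x, E x →L[ℂ] E x}
  [IsIsometricSMul G Y] [CompactSpace (Base G Y)] [LocallyCompactSpace Y]

namespace HarmonicSetup

/-- The harmonic sections as a linear subspace of the space of all sections of `End ξ`. -/
def submodule (H : HarmonicSetup D 𝒜 m h) : Submodule ℂ (∀ x, E x →L[ℂ] E x) where
  carrier := {f | IsBundleEnd F E f ∧ transfer D m f = f}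
  add_mem' := fun {f g} hf hg => ⟨hf.1.add H.metric hg.1, by
    rw [← transferL_apply, map_add, transferL_apply, transferL_apply, hf.2, hg.2]⟩
  zero_mem' := ⟨by simpa using H.isEnd.smul H.metric 0, map_zero (transferL D m)⟩
  smul_mem' := fun r f hf => ⟨hf.1.smul H.metric r, by
    rw [← transferL_apply, map_smul, transferL_apply, hf.2]⟩

/-- The pointwise vector space structure. -/
abbrev addCommGroup (H : HarmonicSetup D 𝒜 m h) : AddCommGroup (Harmonic D F m) :=
  inferInstanceAs (AddCommGroup H.submodule)

/-- The harmonic section `T₁ g`. -/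
def toHarmonic (H : HarmonicSetup D 𝒜 m h) {g : ∀ x, E x →L[ℂ] E x} (hg : IsBundleEnd F E g) :
    Harmonic D F m :=
  ⟨cesaroProj D m g, H.isBundleEnd_cesaroProj hg, H.transfer_cesaroProj hg⟩

/-- The product `f * g = T₁ (f h⁻¹ g)`. -/
def mul (H : HarmonicSetup D 𝒜 m h) (f g : Harmonic D F m) : Harmonic D F m :=
  H.toHarmonic (H.isBundleEnd_twist f.2.1 g.2.1)

theorem formBound_hnorm (H : HarmonicSetup D 𝒜 m h) (f : Harmonic D F m) :
    FormBound h f.1 (hnorm h f.1) := by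
  obtain ⟨N, hN, h1⟩ := H.exists_formBound f.2.1
  exact h1.formBound_hnorm H.pos H.isUnit hN

/-- The ring of harmonic sections; its unit is `h`. -/
abbrev ring (H : HarmonicSetup D 𝒜 m h) : Ring (Harmonic D F m) :=
  { H.addCommGroup with
    mul := H.mul
    one := ⟨h, H.isEnd, H.harmonic⟩
    left_distrib := fun f g k => Subtype.ext <| by
      change cesaroProj D m (twist h f.1 (g.1 + k.1)) =
        cesaroProj D m (twist h f.1 g.1) + cesaroProj D m (twist h f.1 k.1)
      rw [twist_add_right, H.cesaroProj_add (H.isBundleEnd_twist f.2.1 g.2.1)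
        (H.isBundleEnd_twist f.2.1 k.2.1)]
    right_distrib := fun f g k => Subtype.ext <| by
      change cesaroProj D m (twist h (f.1 + g.1) k.1) =
        cesaroProj D m (twist h f.1 k.1) + cesaroProj D m (twist h g.1 k.1)
      rw [twist_add_left, H.cesaroProj_add (H.isBundleEnd_twist f.2.1 k.2.1)
        (H.isBundleEnd_twist g.2.1 k.2.1)]
    zero_mul := fun f => Subtype.ext <| by
      have h1 : IsBundleEnd F E (0 : ∀ x, E x →L[ℂ] E x) := H.submodule.zero_mem.1
      have h2 : twist h (0 : ∀ x, E x →L[ℂ] E x) f.1 = 0 := by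
        simpa using twist_smul_left (h := h) 0 (0 : ∀ x, E x →L[ℂ] E x) f.1
      change cesaroProj D m (twist h 0 f.1) = 0
      rw [h2, H.cesaroProj_of_fixed h1 H.submodule.zero_mem.2]
    mul_zero := fun f => Subtype.ext <| by
      have h1 : IsBundleEnd F E (0 : ∀ x, E x →L[ℂ] E x) := H.submodule.zero_mem.1
      have h2 : twist h f.1 (0 : ∀ x, E x →L[ℂ] E x) = 0 := by
        simpa using twist_smul_right (h := h) 0 f.1 (0 : ∀ x, E x →L[ℂ] E x)
      change cesaroProj D m (twist h f.1 0) = 0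
      rw [h2, H.cesaroProj_of_fixed h1 H.submodule.zero_mem.2]
    mul_assoc := fun f g k => Subtype.ext <| by
      change cesaroProj D m (twist h (cesaroProj D m (twist h f.1 g.1)) k.1) =
        cesaroProj D m (twist h f.1 (cesaroProj D m (twist h g.1 k.1)))
      rw [H.cesaroProj_twist_cesaroProj_left (H.isBundleEnd_twist f.2.1 g.2.1) k.2.1 k.2.2,
        H.cesaroProj_twist_cesaroProj_right (H.isBundleEnd_twist g.2.1 k.2.1) f.2.1 f.2.2,
        twist_assoc]
    one_mul := fun f => Subtype.ext <| by
      change cesaroProj D m (twist h h f.1) = f.1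
      rw [twist_self_left H.isUnit, H.cesaroProj_of_fixed f.2.1 f.2.2]
    mul_one := fun f => Subtype.ext <| by
      change cesaroProj D m (twist h f.1 h) = f.1
      rw [twist_self_right H.isUnit, H.cesaroProj_of_fixed f.2.1 f.2.2] }

/-- The norm `‖·‖_h` as a norm on the additive group of harmonic sections. -/
def addGroupNorm (H : HarmonicSetup D 𝒜 m h) :
    letI := H.addCommGroup; AddGroupNorm (Harmonic D F m) :=
  letI := H.addCommGroup
  { toFun := fun f => hnorm h f.1
    map_zero' := le_antisymm (FormBound.zero.hnorm_le H.pos H.isUnit le_rfl) (hnorm_nonneg _)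
    add_le' := fun f g => ((H.formBound_hnorm f).add (H.formBound_hnorm g)).hnorm_le H.pos H.isUnit
      (add_nonneg (hnorm_nonneg _) (hnorm_nonneg _))
    neg' := fun f => le_antisymm
      ((H.formBound_hnorm f).neg.hnorm_le H.pos H.isUnit (hnorm_nonneg _))
      (by
        have h1 := (H.formBound_hnorm (-f)).neg.hnorm_le H.pos H.isUnit (hnorm_nonneg _)
        change hnorm h (- -f.1) ≤ _ at h1
        rwa [neg_neg] at h1)
    eq_zero_of_map_eq_zero' := fun f hf => Subtype.ext <| by
      have h1 := H.formBound_hnorm f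
      rw [show hnorm h f.1 = 0 from hf] at h1
      exact h1.eq_zero }

/-- The normed ring of harmonic sections. -/
abbrev normedRing (H : HarmonicSetup D 𝒜 m h) : NormedRing (Harmonic D F m) :=
  letI := H.ring
  { H.ring, H.addGroupNorm.toNormedAddCommGroup with
    norm_mul_le := fun f g =>
      (H.formBound_cesaroProj (H.isBundleEnd_twist f.2.1 g.2.1)
        (mul_nonneg (hnorm_nonneg _) (hnorm_nonneg _))
        (FormBound.twist H.pos H.isUnit (hnorm_nonneg _) (hnorm_nonneg _)
          (H.formBound_hnorm f) (H.formBound_hnorm g))).hnorm_le H.pos H.isUnit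
        (mul_nonneg (hnorm_nonneg _) (hnorm_nonneg _)) }

/-- The normed algebra of harmonic sections. -/
abbrev normedAlgebra (H : HarmonicSetup D 𝒜 m h) :
    letI := H.normedRing; NormedAlgebra ℂ (Harmonic D F m) :=
  letI := H.normedRing
  letI : Module ℂ (Harmonic D F m) := inferInstanceAs (Module ℂ H.submodule)
  { Algebra.ofModule (R := ℂ) (A := Harmonic D F m)
      (fun r f g => Subtype.ext <| by
        change cesaroProj D m (twist h (r • f.1) g.1) = r • cesaroProj D m (twist h f.1 g.1)
        rw [twist_smul_left, H.cesaroProj_smul _ (H.isBundleEnd_twist f.2.1 g.2.1)])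
      (fun r f g => Subtype.ext <| by
        change cesaroProj D m (twist h f.1 (r • g.1)) = r • cesaroProj D m (twist h f.1 g.1)
        rw [twist_smul_right, H.cesaroProj_smul _ (H.isBundleEnd_twist f.2.1 g.2.1)]) with
    norm_smul_le := fun r f => ((H.formBound_hnorm f).smul r).hnorm_le H.pos H.isUnit
      (mul_nonneg (norm_nonneg _) (hnorm_nonneg _)) }

/-- The fibrewise adjoint as an involution of the ring of harmonic sections. -/
abbrev starRing (H : HarmonicSetup D 𝒜 m h) : letI := H.ring; StarRing (Harmonic D F m) :=
  letI := H.ring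
  { star := fun f => ⟨starSec f.1, H.isBundleEnd_starSec f.2.1, transfer_starSec_eq f.2.2⟩
    star_involutive := fun f => Subtype.ext (starSec_starSec f.1)
    star_mul := fun f g => Subtype.ext <| by
      change starSec (cesaroProj D m (twist h f.1 g.1)) =
        cesaroProj D m (twist h (starSec g.1) (starSec f.1))
      rw [← H.cesaroProj_starSec (H.isBundleEnd_twist f.2.1 g.2.1), starSec_twist H.pos]
    star_add := fun f g => Subtype.ext (starSec_add f.1 g.1) }

/-- Harmonic sections are determined by their values at finitely many points, in fibres of finite
dimension. -/
theorem finiteDimensional (H : HarmonicSetup D 𝒜 m h) :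
    letI := H.normedRing; letI := H.normedAlgebra;
    FiniteDimensional ℂ (Harmonic D F m) := by
  let := H.normedRing
  let := H.normedAlgebra
  obtain ⟨s, hs⟩ := H.exists_finset_eq_zero
  have (c : s) := finiteDimensional_fiber F (E := E) (proj G c.1)
  let ev : Harmonic D F m →ₗ[ℂ] (∀ c : s, E (proj G c.1) →L[ℂ] E (proj G c.1)) :=
    { toFun := fun f c => f.1 (proj G c.1)
      map_add' := fun _ _ => rfl
      map_smul' := fun _ _ => rfl }
  refine FiniteDimensional.of_injective ev ((injective_iff_map_eq_zero ev).2 fun f hf => ?_)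
  exact Subtype.ext (hs f.1 f.2.1 f.2.2 fun c hc => congrFun hf ⟨c, hc⟩)

/-- The `C*`-identity: `T₁ (f* h⁻¹ f) ≤ ‖f* * f‖_h h`, and this dominates `f* h⁻¹ f` by the Schwarz
inequality. -/
theorem hnorm_mul_self_le (H : HarmonicSetup D 𝒜 m h) (f : Harmonic D F m) :
    hnorm h f.1 * hnorm h f.1 ≤ hnorm h (cesaroProj D m (twist h (starSec f.1) f.1)) := by
  have h1 := H.blockPos_cesaroProj_twist f.2.1
  rw [H.cesaroProj_of_fixed f.2.1 f.2.2] at h1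
  have h2 := H.formBound_hnorm
    (H.toHarmonic (H.isBundleEnd_twist (H.isBundleEnd_starSec f.2.1) f.2.1))
  change FormBound h (cesaroProj D m (twist h (starSec f.1) f.1)) _ at h2
  refine le_of_forall_gt_imp_ge_of_dense fun c hc => ?_
  have hc0 : 0 < c := (hnorm_nonneg _).trans_lt hc
  have h3 := (h1.formBound hc0 (h2.mono H.pos hc.le)).hnorm_le H.pos H.isUnit
    (Real.sqrt_nonneg c)
  calc hnorm h f.1 * hnorm h f.1 ≤ Real.sqrt c * Real.sqrt c :=
        mul_self_le_mul_self (hnorm_nonneg _) h3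
    _ = c := Real.mul_self_sqrt hc0.le

/-- The `C*`-algebra of harmonic sections. -/
abbrev cstarAlgebra (H : HarmonicSetup D 𝒜 m h) : CStarAlgebra (Harmonic D F m) :=
  letI := H.normedRing
  letI := H.normedAlgebra
  letI := H.starRing
  haveI := H.finiteDimensional
  haveI : CompleteSpace (Harmonic D F m) := FiniteDimensional.complete ℂ _
  { H.normedRing, H.normedAlgebra, H.starRing with
    complete := CompleteSpace.complete
    norm_mul_self_le := H.hnorm_mul_self_le
    star_smul := fun r f => Subtype.ext (starSec_smul r f.1) }

end HarmonicSetup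

end Algebra

end MatrixTransfer

end

theorem mainTheorem1
    {G Y : Type*} [Group G] [MulAction G Y] [MetricSpace Y] [LocallyCompactSpace Y]
    [IsIsometricSMul G Y] [ProperlyDiscontinuousSMul G Y]
    (hp : IsQuotientCoveringMap (MatrixTransfer.proj G : Y → MatrixTransfer.Base G Y) G)
    [CompactSpace (MatrixTransfer.Base G Y)]
    (D : MatrixTransfer.Dilation G Y)
    (d : ℕ) (E : MatrixTransfer.Base G Y → Type*)
    [∀ x, NormedAddCommGroup (E x)] [∀ x, InnerProductSpace ℂ (E x)] [∀ x, CompleteSpace (E x)]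
    [TopologicalSpace (TotalSpace (EuclideanSpace ℂ (Fin d)) E)]
    [FiberBundle (EuclideanSpace ℂ (Fin d)) E] [VectorBundle ℂ (EuclideanSpace ℂ (Fin d)) E]
    (hmetric : MatrixTransfer.IsHermitianMetric (EuclideanSpace ℂ (Fin d)) E)
    (𝒜 : MatrixTransfer.LipschitzAtlas (EuclideanSpace ℂ (Fin d)) E)
    (htriv : MatrixTransfer.PullbackIsTrivial (EuclideanSpace ℂ (Fin d)) E d)
    (m : ∀ x, E (D.baseMap x) →L[ℂ] E x) (hm : 𝒜.IsLipschitzMap D m)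
    (h : ∀ x, E x →L[ℂ] E x)
    (h_end : MatrixTransfer.IsBundleEnd (EuclideanSpace ℂ (Fin d)) E h)
    (h_harmonic : MatrixTransfer.transfer D m h = h)
    (h_pos : ∀ x, (h x).IsPositive) (h_unit : ∀ x, IsUnit (h x)) :
    (∀ g : ∀ x, E x →L[ℂ] E x, MatrixTransfer.IsBundleEnd (EuclideanSpace ℂ (Fin d)) E g →
      (∀ ε > 0, ∃ N : ℕ, ∀ k ≥ N, ∀ x,
        ‖MatrixTransfer.cesaro D m g k x - MatrixTransfer.cesaroProj D m g x‖ < ε) ∧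
      MatrixTransfer.IsBundleEnd (EuclideanSpace ℂ (Fin d)) E (MatrixTransfer.cesaroProj D m g) ∧
      MatrixTransfer.transfer D m (MatrixTransfer.cesaroProj D m g) =
        MatrixTransfer.cesaroProj D m g) ∧
    ∃ _ : CStarAlgebra (MatrixTransfer.Harmonic D (EuclideanSpace ℂ (Fin d)) m),
      FiniteDimensional ℂ (MatrixTransfer.Harmonic D (EuclideanSpace ℂ (Fin d)) m) ∧
      (∀ (f g : MatrixTransfer.Harmonic D (EuclideanSpace ℂ (Fin d)) m) (x),
        (f + g).1 x = f.1 x + g.1 x) ∧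
      (∀ (c : ℂ) (f : MatrixTransfer.Harmonic D (EuclideanSpace ℂ (Fin d)) m) (x),
        (c • f).1 x = c • f.1 x) ∧
      (∀ (f : MatrixTransfer.Harmonic D (EuclideanSpace ℂ (Fin d)) m) (x),
        (star f).1 x = ContinuousLinearMap.adjoint (f.1 x)) ∧
      (∀ f g : MatrixTransfer.Harmonic D (EuclideanSpace ℂ (Fin d)) m,
        (f * g).1 = MatrixTransfer.cesaroProj D m (fun x => f.1 x * Ring.inverse (h x) * g.1 x)) ∧
      (∀ f : MatrixTransfer.Harmonic D (EuclideanSpace ℂ (Fin d)) m,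
        ‖f‖ = ⨆ x, ‖(h x) ^ (-(1 / 2) : ℝ) * f.1 x * (h x) ^ (-(1 / 2) : ℝ)‖) := by
  have H : MatrixTransfer.HarmonicSetup D 𝒜 m h :=
    ⟨hmetric, hm, h_end, h_harmonic, h_pos, h_unit⟩
  refine ⟨fun g hg => ⟨fun ε hε => H.cesaro_uniform hg hε, H.isBundleEnd_cesaroProj hg,
    H.transfer_cesaroProj hg⟩, H.cstarAlgebra, H.finiteDimensional, ?_⟩
  exact ⟨fun _ _ _ => rfl, fun _ _ _ => rfl, fun _ _ => rfl, fun _ _ => rfl, fun _ => rfl⟩
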